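/- **Theorem 3.11.** Let $d\ge 2$ and $3\le k\le d+1$ be integers. Let $X_1,X_2,\dots$ be i.i.d. random points in $\mathbb{R}^d$ with a bounded density $f$ and, for each $n$, let $N_n$ be a Poisson random variable with mean $n$, independent of $(X_i)_{i\ge1}$; put $\mathcal{P}_n=\{X_1,\dots,X_{N_n}\}$. Let $r_n\ge 0$. Write $B_r(x)$ for the closed ball of radius $r$ about $x$. Points $x_1,\dots,x_k$ form an *empty $(k-1)$-simplex* with respect to $r$ if $\bigcap_{j\ne j_0}B_r(x_j)\ne\emptyset$ for every $j_0\in\{1,\dots,k\}$, but $\bigcap_{j=1}^kB_r(x_j)=\emptyset$. Let $\widetilde S^P_{n,k}$ be the number of *isolated* empty $(k-1)$-simplices in $\mathcal{P}_n$, i.e. the number of index sets $\{i_1<\dots<i_k\}\subseteq\{1,\dots,N_n\}$ such that $X_{i_1},\dots,X_{i_k}$ form an empty $(k-1)$-simplex with respect to $r_n$ and $|X_i-X_j|>2r_n$ whenever $i\in\{i_1,\dots,i_k\}$ and $j\in\{1,\dots,N_n\}\setminus\{i_1,\dots,i_k\}$. If $n^kr_n^{d(k-1)}\to\infty$ and $nr_n^d\to0$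 as $n\to\infty$, then $\widetilde S^P_{n,k}$ has finite second moment for every $n$, and $$\frac{\widetilde S^P_{n,k}-\mathbb{E}\big[\widetilde S^P_{n,k}\big]}{\sqrt{\mathrm{Var}\big[\widetilde S^P_{n,k}\big]}}\Rightarrow\mathcal{N}(0,1)\qquad(n\to\infty),$$ where $\Rightarrow$ denotes weak convergence and the quotient is read as $0$ for those (at most finitely many) $n$ with zero variance. -/

import Mathlib

open MeasureTheory ProbabilityTheory Filter Topology
open scoped NNReal ENNReal

/-- The points `x i`, `i ∈ s`, form an empty simplex with respect to the radius `r`: the closed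
balls of radius `r` about any `#s - 1` of them have a common point, but the balls about all of
them do not. With `#s = k` this is an empty `(k - 1)`-simplex. -/
def IsEmptySimplex {d : ℕ} (r : ℝ) (x : ℕ → EuclideanSpace ℝ (Fin d)) (s : Finset ℕ) : Prop :=
  (∀ j ∈ s, (⋂ i ∈ s.erase j, Metric.closedBall (x i) r).Nonempty) ∧
    (⋂ i ∈ s, Metric.closedBall (x i) r) = ∅

/-- No edge (pair at distance at most `2 * r`) joins a point with index in `s` to one of the points
`x 0, …, x (m - 1)` with index outside `s`. -/
def IsIsolated {d : ℕ} (r : ℝ) (x : ℕ → EuclideanSpace ℝ (Fin d)) (m : ℕ) (s : Finset ℕ) : Prop :=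
  ∀ i ∈ s, ∀ j ∈ Finset.range m \ s, ¬ dist (x i) (x j) ≤ 2 * r

open Classical in
/-- The number of isolated empty `(k - 1)`-simplices formed by the points
`x 0, …, x (m - 1)`. -/
noncomputable def isolatedCount {d : ℕ} (k : ℕ) (r : ℝ) (x : ℕ → EuclideanSpace ℝ (Fin d))
    (m : ℕ) : ℕ :=
  (((Finset.range m).powersetCard k).filter
    fun s => IsEmptySimplex r x s ∧ IsIsolated r x m s).card

/-- The Poissonized count: the number of isolated empty `(k - 1)`-simplices formed by the
first `N ω` points of the random sequence `X`. -/
noncomputable def poissonizedCount {Ω : Type*} {d : ℕ} (k : ℕ) (r : ℝ)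
    (X : ℕ → Ω → EuclideanSpace ℝ (Fin d)) (N : Ω → ℕ) (ω : Ω) : ℝ :=
  (isolatedCount k r (fun i => X i ω) (N ω) : ℝ)

/-! The count `W` is treated as approximately Poisson in the sense of Stein's equation, with mean
`λ` tending to infinity; the Gaussian limit is then read off from characteristic functions.

Since `k ≥ 3`, any two vertices of an empty simplex lie on a common proper face, hence within `2r`
of each other. Distinct isolated simplices are therefore disjoint, and removing one lowers `W` by
exactly one (`card_isolatedSimplices_sdiff`). A Mecke-type splitting formula for Poisson samples
(`lintegral_sum_powerset_poissonSample`) and thinning (`lintegral_filter_poissonSample`) then give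
the size-bias identity `lintegral_isolatedCount_mul`: `E[W f(W)]` is the integral of `E[f(1 + W')]`
against the simplex intensity, where `W'` counts after deletion of the points near a fixed simplex.
Deletion affects only simplices with a vertex in a ball of radius `6r`, which contains at most `ρ =
O(n r^d)` points on average. Hence `|E[W g(W)] - λ E[g(1 + W)]| ≤ 2ρλ` for every 1-Lipschitz `g`
(`norm_integral_isolatedCount_smul_sub_le`).

The choice `g(a) = a` gives `Var W / λ → 1`. The choice of `g` as a rescaled exponential shows that
the standardized count `Z` nearly satisfies `E[Z exp(isZ)] = i s E[exp(isZ)]`, a differential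
equation for its characteristic function with solution `exp(-s²/2)`; the error vanishes when `ρ → 0`
and `λ → ∞` (`tendsto_charFun_standardized`).

For `λ → ∞`, the mean is at least `n^k e^{-ρ} / k!` times the probability that `k` points form an
empty simplex. As `k ≤ d + 1`, empty simplices of a given size contain a ball of configurations,
stable under translation and scaling, so by Fubini, Lebesgue differentiation and Fatou this
probability is eventually at least `c r^{d(k-1)}` (`exists_le_infinitePi_isEmptySimplex`). -/

/-! ### Combinatorics of isolated empty simplices -/

section Combinatorics

variable {d k : ℕ} {r : ℝ}

open Classical in
/-- The isolated empty `(k - 1)`-simplices among the points `x i`, `i ∈ t`. -/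
noncomputable def isolatedSimplices (k : ℕ) (r : ℝ) (x : ℕ → EuclideanSpace ℝ (Fin d))
    (t : Finset ℕ) : Finset (Finset ℕ) :=
  (t.powersetCard k).filter fun s =>
    IsEmptySimplex r x s ∧ ∀ i ∈ s, ∀ j ∈ t \ s, ¬ dist (x i) (x j) ≤ 2 * r

lemma isolatedCount_eq_card (k : ℕ) (r : ℝ) (x : ℕ → EuclideanSpace ℝ (Fin d)) (m : ℕ) :
    isolatedCount k r x m = (isolatedSimplices k r x (Finset.range m)).card := by
  unfold isolatedCount isolatedSimplices IsIsolated
  congr!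

lemma mem_isolatedSimplices {x : ℕ → EuclideanSpace ℝ (Fin d)} {t s : Finset ℕ} :
    s ∈ isolatedSimplices k r x t ↔ (s ⊆ t ∧ s.card = k) ∧ IsEmptySimplex r x s ∧
      ∀ i ∈ s, ∀ j ∈ t, j ∉ s → ¬ dist (x i) (x j) ≤ 2 * r := by
  simp [isolatedSimplices, Finset.mem_powersetCard]

lemma isEmptySimplex_comp_perm (σ : Equiv.Perm ℕ) (x : ℕ → EuclideanSpace ℝ (Fin d))
    (s : Finset ℕ) :
    IsEmptySimplex r (x ∘ σ) s ↔ IsEmptySimplex r x (s.map σ.toEmbedding) := by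
  have h (u : Finset ℕ) : (⋂ i ∈ u.map σ.toEmbedding, Metric.closedBall (x i) r) =
      ⋂ i ∈ u, Metric.closedBall ((x ∘ σ) i) r := by
    ext v; simp only [Set.mem_iInter, Finset.forall_mem_map]; rfl
  have h' (j : ℕ) : (s.map σ.toEmbedding).erase (σ j) = (s.erase j).map σ.toEmbedding := by
    rw [Finset.map_erase]; rfl
  unfold IsEmptySimplex
  rw [h]
  simp only [Finset.forall_mem_map, Equiv.coe_toEmbedding, h', h]

lemma isEmptySimplex_congr {x y : ℕ → EuclideanSpace ℝ (Fin d)} {s : Finset ℕ}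
    (h : ∀ i ∈ s, x i = y i) : IsEmptySimplex r x s ↔ IsEmptySimplex r y s := by
  have h' (u : Finset ℕ) (hu : u ⊆ s) : (⋂ i ∈ u, Metric.closedBall (x i) r) =
      ⋂ i ∈ u, Metric.closedBall (y i) r :=
    Set.iInter₂_congr fun i hi => by rw [h i (hu hi)]
  unfold IsEmptySimplex
  rw [h' s subset_rfl]
  refine and_congr_left fun _ => forall₂_congr fun j _ => ?_
  rw [h' _ (Finset.erase_subset _ _)]

lemma isolatedSimplices_congr {x y : ℕ → EuclideanSpace ℝ (Fin d)} {t : Finset ℕ}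
    (h : ∀ i ∈ t, x i = y i) : isolatedSimplices k r x t = isolatedSimplices k r y t := by
  ext s
  simp only [mem_isolatedSimplices]
  refine and_congr_right fun hs => ?_
  rw [isEmptySimplex_congr fun i hi => h i (hs.1 hi)]
  refine and_congr_right fun _ => forall₂_congr fun i hi => forall₂_congr fun j hj => ?_
  rw [h i (hs.1 hi), h j hj]

lemma isolatedSimplices_map_perm (σ : Equiv.Perm ℕ) (x : ℕ → EuclideanSpace ℝ (Fin d))
    (t : Finset ℕ) :
    isolatedSimplices k r x (t.map σ.toEmbedding) =
      (isolatedSimplices k r (x ∘ σ) t).map (Finset.mapEmbedding σ.toEmbedding).toEmbedding := by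
  ext s
  obtain ⟨s, rfl⟩ : ∃ u : Finset ℕ, s = u.map σ.toEmbedding :=
    ⟨s.map σ.symm.toEmbedding, by ext; simp⟩
  have : s.map σ.toEmbedding = (Finset.mapEmbedding σ.toEmbedding).toEmbedding s := rfl
  rw [this, Finset.mem_map', ← this]
  simp only [mem_isolatedSimplices, isEmptySimplex_comp_perm, Finset.map_subset_map,
    Finset.card_map, Finset.forall_mem_map, Finset.mem_map']
  rfl

lemma card_isolatedSimplices_comp_perm (σ : Equiv.Perm ℕ) (x : ℕ → EuclideanSpace ℝ (Fin d))
    (t : Finset ℕ) :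
    (isolatedSimplices k r (x ∘ σ) t).card =
      (isolatedSimplices k r x (t.map σ.toEmbedding)).card := by
  rw [isolatedSimplices_map_perm, Finset.card_map]

/-- In an empty simplex with at least three vertices all vertices are joined by edges. -/
lemma IsEmptySimplex.dist_le {x : ℕ → EuclideanSpace ℝ (Fin d)} {s : Finset ℕ}
    (h : IsEmptySimplex r x s) (hs : 3 ≤ s.card) {i j : ℕ} (hi : i ∈ s) (hj : j ∈ s) :
    dist (x i) (x j) ≤ 2 * r := by
  -- A third vertex `l` exists because `s` has at least three; the balls of the face opposite `l`,
  -- which contains `i` and `j`, share a point `v`.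
  obtain ⟨l, hl, hlij⟩ : ∃ l ∈ s, l ∉ ({i, j} : Finset ℕ) :=
    Finset.exists_mem_notMem_of_card_lt_card (Finset.card_le_two.trans_lt hs)
  obtain ⟨hli, hlj⟩ : l ≠ i ∧ l ≠ j := by simpa using hlij
  obtain ⟨v, hv⟩ := h.1 l hl
  simp only [Set.mem_iInter, Metric.mem_closedBall] at hv
  have h1 := hv i (Finset.mem_erase.2 ⟨hli.symm, hi⟩)
  have h2 := hv j (Finset.mem_erase.2 ⟨hlj.symm, hj⟩)
  have := dist_triangle_left (x i) (x j) v
  linarith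

/-- A vertex of `u` outside `s` would be within `2r` of the shared vertex, contradicting the
isolation of `s`; so `u ⊆ s`, and the cardinalities agree. -/
lemma eq_of_mem_isolatedSimplices (hk : 3 ≤ k) {x : ℕ → EuclideanSpace ℝ (Fin d)}
    {t s u : Finset ℕ} (hs : s ∈ isolatedSimplices k r x t) (hu : u ∈ isolatedSimplices k r x t)
    {i : ℕ} (his : i ∈ s) (hiu : i ∈ u) : s = u := by
  rw [mem_isolatedSimplices] at hs hu
  refine (Finset.eq_of_subset_of_card_le (fun j hj => ?_) (by omega)).symm
  by_contra hjs
  exact hs.2.2 i his j (hu.1.1 hj) hjs (hu.2.1.dist_le (by omega) hiu hj)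

/-- Removing an isolated empty simplex lowers the count by one. -/
lemma card_isolatedSimplices_sdiff (hk : 3 ≤ k) {x : ℕ → EuclideanSpace ℝ (Fin d)}
    {t s : Finset ℕ} (hs : s ∈ isolatedSimplices k r x t) :
    (isolatedSimplices k r x t).card = 1 + (isolatedSimplices k r x (t \ s)).card := by
  have key : isolatedSimplices k r x t = insert s (isolatedSimplices k r x (t \ s)) := by
    have hs' := mem_isolatedSimplices.1 hs
    ext u
    rw [Finset.mem_insert]
    constructor
    · intro hu
      by_cases hus : u = s
      · exact Or.inl hus
      right
      have hu' := mem_isolatedSimplices.1 hu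
      refine mem_isolatedSimplices.2 ⟨⟨fun i hi => Finset.mem_sdiff.2 ⟨hu'.1.1 hi, fun his =>
        hus (eq_of_mem_isolatedSimplices hk hu hs hi his)⟩, hu'.1.2⟩, hu'.2.1,
        fun i hi j hj hju => hu'.2.2 i hi j (Finset.mem_sdiff.1 hj).1 hju⟩
    · rintro (rfl | hu)
      · exact hs
      have hu' := mem_isolatedSimplices.1 hu
      refine mem_isolatedSimplices.2 ⟨⟨hu'.1.1.trans Finset.sdiff_subset, hu'.1.2⟩, hu'.2.1,
        fun i hi j hj hju => ?_⟩
      have hi' := Finset.mem_sdiff.1 (hu'.1.1 hi)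
      -- Restoring the points of `s` does not spoil the isolation of `u`, because `s` is itself
      -- isolated from the points of `u`.
      by_cases hjs : j ∈ s
      · rw [dist_comm]
        exact hs'.2.2 j hjs i hi'.1 hi'.2
      · exact hu'.2.2 i hi j (Finset.mem_sdiff.2 ⟨hj, hjs⟩) hju
  rw [key, Finset.card_insert_of_notMem, add_comm]
  intro h
  obtain ⟨i, hi⟩ : s.Nonempty := Finset.card_pos.1 (by
    have := (mem_isolatedSimplices.1 hs).1.2; omega)
  exact (Finset.mem_sdiff.1 ((mem_isolatedSimplices.1 h).1.1 hi)).2 hi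

-- Isolated simplices are disjoint, so each point of `b` accounts for at most one member of `F`.
open Classical in
lemma card_le_of_forall_meets (hk : 3 ≤ k) {x : ℕ → EuclideanSpace ℝ (Fin d)}
    {t : Finset ℕ} {F : Finset (Finset ℕ)} (hF : F ⊆ isolatedSimplices k r x t) {b : Finset ℕ}
    (h : ∀ s ∈ F, ∃ i ∈ b, i ∈ s) : F.card ≤ b.card :=
  Finset.card_le_card_of_forall_subsingleton (fun s i => i ∈ s) h fun _ _ _ hs _ hu =>
    eq_of_mem_isolatedSimplices hk (hF hs.1) (hF hu.1) hs.2 hu.2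

open Classical in
/-- Deleting the points in a set `B` changes the count by at most twice the number of points near
`B`. -/
lemma abs_card_isolatedSimplices_sub_le (hk : 3 ≤ k) (hr : 0 ≤ r)
    (x : ℕ → EuclideanSpace ℝ (Fin d)) (t : Finset ℕ) (B C : Set (EuclideanSpace ℝ (Fin d)))
    (hBC : ∀ v w, v ∈ B → dist w v ≤ 2 * r → w ∈ C) :
    |((isolatedSimplices k r x t).card : ℝ) -
      (isolatedSimplices k r x (t.filter fun i => x i ∉ B)).card| ≤
      2 * (t.filter fun i => x i ∈ C).card := by
  set F := isolatedSimplices k r x t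
  set G := isolatedSimplices k r x (t.filter fun i => x i ∉ B)
  -- A simplex lost by the deletion has a vertex in `B`, hence in `C`.
  have h1 : (F \ G).card ≤ (t.filter fun i => x i ∈ C).card := by
    refine card_le_of_forall_meets hk Finset.sdiff_subset fun s hs => ?_
    obtain ⟨hsF, hsG⟩ := Finset.mem_sdiff.1 hs
    have hsF' := mem_isolatedSimplices.1 hsF
    have : ¬ ∀ i ∈ s, x i ∉ B := fun hB => hsG <| mem_isolatedSimplices.2
      ⟨⟨fun i hi => Finset.mem_filter.2 ⟨hsF'.1.1 hi, hB i hi⟩, hsF'.1.2⟩, hsF'.2.1,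
        fun i hi j hj hjs => hsF'.2.2 i hi j (Finset.mem_filter.1 hj).1 hjs⟩
    push Not at this
    obtain ⟨i, hi, hiB⟩ := this
    exact ⟨i, Finset.mem_filter.2 ⟨hsF'.1.1 hi, hBC _ _ hiB (by simpa using hr)⟩, hi⟩
  -- A simplex gained by the deletion was previously joined to a point of `B`, so one of its
  -- vertices lies in `C`.
  have h2 : (G \ F).card ≤ (t.filter fun i => x i ∈ C).card := by
    refine card_le_of_forall_meets hk Finset.sdiff_subset fun s hs => ?_
    obtain ⟨hsG, hsF⟩ := Finset.mem_sdiff.1 hs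
    have hsG' := mem_isolatedSimplices.1 hsG
    have hst : s ⊆ t := hsG'.1.1.trans (Finset.filter_subset _ _)
    have : ¬ ∀ i ∈ s, ∀ j ∈ t, j ∉ s → ¬ dist (x i) (x j) ≤ 2 * r := fun hB =>
      hsF <| mem_isolatedSimplices.2 ⟨⟨hst, hsG'.1.2⟩, hsG'.2.1, hB⟩
    push Not at this
    obtain ⟨i, hi, j, hj, hjs, hij⟩ := this
    have hjB : x j ∈ B := by
      by_contra hjB
      exact hsG'.2.2 i hi j (Finset.mem_filter.2 ⟨hj, hjB⟩) hjs hij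
    exact ⟨i, Finset.mem_filter.2 ⟨hst hi, hBC _ _ hjB hij⟩, hi⟩
  have h3 : F.card ≤ (F \ G).card + G.card := by
    rw [← Finset.card_sdiff_add_card_inter F G]
    exact Nat.add_le_add_left (Finset.card_le_card Finset.inter_subset_right) _
  have h4 : G.card ≤ (G \ F).card + F.card := by
    rw [← Finset.card_sdiff_add_card_inter G F]
    exact Nat.add_le_add_left (Finset.card_le_card Finset.inter_subset_right) _
  rw [abs_le]
  have h1' : ((F \ G).card : ℝ) ≤ (t.filter fun i => x i ∈ C).card := by exact_mod_cast h1
  have h2' : ((G \ F).card : ℝ) ≤ (t.filter fun i => x i ∈ C).card := by exact_mod_cast h2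
  have h3' : (F.card : ℝ) ≤ (F \ G).card + G.card := by exact_mod_cast h3
  have h4' : (G.card : ℝ) ≤ (G \ F).card + F.card := by exact_mod_cast h4
  have : (0 : ℝ) ≤ (t.filter fun i => x i ∈ C).card := Nat.cast_nonneg _
  constructor <;> linarith

end Combinatorics

/-! ### Splitting a Poisson sample into two groups (Mecke formula) -/

section PoissonSplitting

lemma exists_perm_map_range_eq (S : Finset ℕ) :
    ∃ σ : Equiv.Perm ℕ, (Finset.range S.card).map σ.toEmbedding = S := by
  have : MulAction.IsMultiplyPretransitive (Equiv.Perm ℕ) ℕ S.card :=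
    Equiv.Perm.isMultiplyPretransitive ℕ S.card
  obtain ⟨σ, hσ⟩ := this.exists_smul_eq Fin.valEmbedding (S.orderEmbOfFin rfl).toEmbedding
  refine ⟨σ, Finset.eq_of_subset_of_card_le ?_ (by simp)⟩
  intro i hi
  obtain ⟨j, hj, rfl⟩ := Finset.mem_map.1 hi
  have := DFunLike.congr_fun hσ ⟨j, Finset.mem_range.1 hj⟩
  have h2 : σ j = S.orderEmbOfFin rfl ⟨j, Finset.mem_range.1 hj⟩ := this
  simp only [Equiv.coe_toEmbedding, h2]
  exact Finset.orderEmbOfFin_mem S rfl _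

variable {α : Type*} [MeasurableSpace α] (ν : Measure α) [IsProbabilityMeasure ν]

lemma map_comp_perm_infinitePi (σ : Equiv.Perm ℕ) :
    (Measure.infinitePi fun _ : ℕ => ν).map (fun x => x ∘ σ) = Measure.infinitePi fun _ => ν := by
  refine Measure.eq_infinitePi _ fun s t ht => ?_
  have hm : Measurable fun x : ℕ → α => x ∘ σ := by
    exact measurable_pi_lambda _ fun i => measurable_pi_apply _
  rw [Measure.map_apply hm (MeasurableSet.pi s.countable_toSet fun i _ => ht i)]
  have : (fun x : ℕ → α => x ∘ σ) ⁻¹' (s : Set ℕ).pi t =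
      ((s.map σ.toEmbedding : Finset ℕ) : Set ℕ).pi (fun i => t (σ.symm i)) := by
    ext x
    simp only [Set.mem_preimage, Set.mem_pi, Finset.mem_coe, Finset.forall_mem_map]
    simp
  rw [this, Measure.infinitePi_pi _ fun i _ => ht _]
  simp

/-- The sequence with the entries of `p.1` at the indices in `T` and those of `p.2` elsewhere. -/
def splice {α : Type*} (T : Finset ℕ) (p : (ℕ → α) × (ℕ → α)) : ℕ → α :=
  fun i => if i ∈ T then p.1 i else p.2 i

lemma measurable_splice (T : Finset ℕ) : Measurable (splice (α := α) T) := by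
  refine measurable_pi_lambda _ fun i => ?_
  unfold splice
  split_ifs <;> fun_prop

/-- Disjoint blocks of coordinates are independent: entries inside and outside `T` may be drawn from
two independent copies of the sequence. -/
lemma map_splice_infinitePi (T : Finset ℕ) :
    ((Measure.infinitePi fun _ : ℕ => ν).prod (Measure.infinitePi fun _ : ℕ => ν)).map
      (splice T) = Measure.infinitePi fun _ => ν := by
  refine Measure.eq_infinitePi _ fun s t ht => ?_
  rw [Measure.map_apply (measurable_splice T)
    (MeasurableSet.pi s.countable_toSet fun i _ => ht i)]
  have : splice T ⁻¹' (s : Set ℕ).pi t =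
      (((s.filter (· ∈ T) : Finset ℕ) : Set ℕ).pi t) ×ˢ
        (((s.filter (· ∉ T) : Finset ℕ) : Set ℕ).pi t) := by
    ext p
    simp only [Set.mem_preimage, Set.mem_pi, splice, Finset.mem_coe, Set.mem_prod,
      Finset.mem_filter]
    constructor
    · intro h
      exact ⟨fun i hi => by simpa [hi.2] using h i hi.1,
        fun i hi => by simpa [hi.2] using h i hi.1⟩
    · intro h i hi
      by_cases hT : i ∈ T
      · simpa [hT] using h.1 i ⟨hi, hT⟩
      · simpa [hT] using h.2 i ⟨hi, hT⟩
  rw [this, Measure.prod_prod, Measure.infinitePi_pi _ fun i _ => ht _,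
    Measure.infinitePi_pi _ fun i _ => ht _, Finset.prod_filter_mul_prod_filter_not]

/-- This cancellation of factorials is where the Poisson law enters: once `i` points are singled
out, the number of remaining points is again Poisson with the same mean. -/
lemma poissonMeasure_singleton_mul_choose (n : ℝ≥0) (i j : ℕ) :
    poissonMeasure n {i + j} * ((i + j).choose j : ℝ≥0∞) =
      (n : ℝ≥0∞) ^ i / (i.factorial : ℝ≥0∞) * poissonMeasure n {j} := by
  have h (a : ℕ) : (a.factorial : ℝ) ≠ 0 := by positivity
  have h1 : ((n : ℝ≥0∞) ^ i / (i.factorial : ℝ≥0∞)) =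
      ENNReal.ofReal ((n : ℝ) ^ i / i.factorial) := by
    rw [ENNReal.ofReal_div_of_pos (by positivity), ENNReal.ofReal_pow (by positivity),
      ENNReal.ofReal_coe_nnreal, ENNReal.ofReal_natCast]
  rw [poissonMeasure_singleton, poissonMeasure_singleton, h1, ← ENNReal.ofReal_natCast,
    ← ENNReal.ofReal_mul (by positivity), ← ENNReal.ofReal_mul (by positivity)]
  congr 1
  have := Nat.add_choose_mul_factorial_mul_factorial i j
  have h2 : ((i + j).choose j : ℝ) * i.factorial * j.factorial = (i + j).factorial := by
    exact_mod_cast this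
  rw [← h2]
  have h3 : ((i + j).choose j : ℝ) ≠ 0 := by
    exact_mod_cast (Nat.choose_pos (Nat.le_add_left j i)).ne'
  field_simp [h i, h j]
  ring

/-- The law of a Poisson number of independent points, given as a number and a sequence. -/
noncomputable def poissonSample (n : ℝ≥0) : Measure (ℕ × (ℕ → α)) :=
  (poissonMeasure n).prod (Measure.infinitePi fun _ => ν)

instance (n : ℝ≥0) : IsProbabilityMeasure (poissonSample ν n) := by
  unfold poissonSample; infer_instance

lemma lintegral_poissonSample (n : ℝ≥0) {F : ℕ × (ℕ → α) → ℝ≥0∞} (hF : Measurable F) :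
    ∫⁻ p, F p ∂poissonSample ν n =
      ∑' m, poissonMeasure n {m} * ∫⁻ x, F (m, x) ∂Measure.infinitePi fun _ => ν := by
  rw [poissonSample, lintegral_prod _ hF.aemeasurable, lintegral_countable']
  simp_rw [mul_comm]

/-- Splitting the points of a Poisson sample into two groups in all possible ways: for a symmetric
functional `K`, the sum over all ways becomes an integral over two independent samples. -/
theorem lintegral_sum_powerset_poissonSample (n : ℝ≥0)
    (K : (ℕ → α) → Finset ℕ → (ℕ → α) → Finset ℕ → ℝ≥0∞)
    (hK_meas : ∀ S T, Measurable fun p : (ℕ → α) × (ℕ → α) => K p.1 S p.2 T)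
    (hK_perm : ∀ (σ τ : Equiv.Perm ℕ) y S z T,
      K (y ∘ σ) S (z ∘ τ) T = K y (S.map σ.toEmbedding) z (T.map τ.toEmbedding))
    (hK_congr : ∀ y y' S z z' T, (∀ i ∈ S, y i = y' i) → (∀ i ∈ T, z i = z' i) →
      K y S z T = K y' S z' T) :
    ∫⁻ p, ∑ T ∈ (Finset.range p.1).powerset, K p.2 (Finset.range p.1 \ T) p.2 T
        ∂poissonSample ν n =
      ∑' l : ℕ, (n : ℝ≥0∞) ^ l / (l.factorial : ℝ≥0∞) *
        ∫⁻ y, ∫⁻ p, K y (Finset.range l) p.2 (Finset.range p.1) ∂poissonSample ν n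
          ∂Measure.infinitePi fun _ => ν := by
  set P := Measure.infinitePi fun _ : ℕ => ν with hP
  set A : Finset ℕ → Finset ℕ → ℝ≥0∞ := fun S T => ∫⁻ p, K p.1 S p.2 T ∂P.prod P with hA
  have hA_perm (σ τ : Equiv.Perm ℕ) (S T : Finset ℕ) :
      A (S.map σ.toEmbedding) (T.map τ.toEmbedding) = A S T := by
    have hm (σ : Equiv.Perm ℕ) : Measurable fun x : ℕ → α => x ∘ σ :=
      measurable_pi_lambda _ fun i => measurable_pi_apply _
    have : P.prod P = (P.prod P).map (Prod.map (fun x => x ∘ σ) (fun x => x ∘ τ)) := by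
      rw [← Measure.map_prod_map _ _ (hm σ) (hm τ), map_comp_perm_infinitePi,
        map_comp_perm_infinitePi]
    simp only [hA]
    conv_rhs => rw [this, lintegral_map (hK_meas S T) ((hm σ).prodMap (hm τ))]
    simp only [Prod.map_fst, Prod.map_snd, hK_perm]
  -- By exchangeability only the sizes of the two groups matter.
  have hA_card (S T : Finset ℕ) : A S T = A (Finset.range S.card) (Finset.range T.card) := by
    obtain ⟨σ, hσ⟩ := exists_perm_map_range_eq S
    obtain ⟨τ, hτ⟩ := exists_perm_map_range_eq T
    conv_lhs => rw [← hσ, ← hτ, hA_perm]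
  have hA_iter (S T : Finset ℕ) : A S T = ∫⁻ y, ∫⁻ z, K y S z T ∂P ∂P :=
    lintegral_prod _ (hK_meas S T).aemeasurable
  have hKd (S T : Finset ℕ) : Measurable fun x => K x S x T :=
    (hK_meas S T).comp (measurable_id.prodMk measurable_id)
  have hsplit (S T : Finset ℕ) (hST : Disjoint S T) : ∫⁻ x, K x S x T ∂P = A S T := by
    rw [hP, ← map_splice_infinitePi ν S, lintegral_map (hKd S T) (measurable_splice S), ← hP]
    refine lintegral_congr fun p => hK_congr _ _ _ _ _ _ (fun i hi => ?_) fun i hi => ?_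
    · simp [splice, hi]
    · simp [splice, Finset.disjoint_right.1 hST hi]
  have hmeas : Measurable fun p : ℕ × (ℕ → α) =>
      ∑ T ∈ (Finset.range p.1).powerset, K p.2 (Finset.range p.1 \ T) p.2 T :=
    measurable_from_prod_countable_right fun m =>
      Finset.measurable_fun_sum (Finset.range m).powerset fun T _ => hKd (Finset.range m \ T) T
  have hmeas' (l : ℕ) : Measurable fun q : (ℕ → α) × (ℕ × (ℕ → α)) =>
      K q.1 (Finset.range l) q.2.2 (Finset.range q.2.1) := by
    have h : Measurable fun q : ℕ × ((ℕ → α) × (ℕ → α)) =>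
        K q.2.1 (Finset.range l) q.2.2 (Finset.range q.1) :=
      measurable_from_prod_countable_right fun m => hK_meas (Finset.range l) (Finset.range m)
    exact h.comp (f := fun q : (ℕ → α) × (ℕ × (ℕ → α)) => (q.2.1, (q.1, q.2.2))) (by fun_prop)
  have hleft (m : ℕ) : ∫⁻ x, ∑ T ∈ (Finset.range m).powerset, K x (Finset.range m \ T) x T ∂P =
      ∑ q ∈ Finset.HasAntidiagonal.antidiagonal m,
        (m.choose q.2 : ℝ≥0∞) * A (Finset.range q.1) (Finset.range q.2) := by
    rw [lintegral_finsetSum _ fun T _ => hKd _ _]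
    have : ∀ T ∈ (Finset.range m).powerset, ∫⁻ x, K x (Finset.range m \ T) x T ∂P =
        A (Finset.range (m - T.card)) (Finset.range T.card) := fun T hT => by
      rw [hsplit _ _ Finset.sdiff_disjoint, hA_card,
        Finset.card_sdiff_of_subset (Finset.mem_powerset.1 hT), Finset.card_range]
    rw [Finset.sum_congr rfl this,
      Finset.sum_powerset_apply_card (fun j => A (Finset.range (m - j)) (Finset.range j)),
      Finset.card_range, ← Finset.Nat.sum_antidiagonal_swap,
      Finset.Nat.sum_antidiagonal_eq_sum_range_succ_mk]
    exact Finset.sum_congr rfl fun j _ => by simp [nsmul_eq_mul]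
  rw [lintegral_poissonSample ν n hmeas]
  simp only [← hP, hleft]
  -- Regrouping by the two group sizes instead of their sum `m` turns the series into an independent
  -- double sum.
  have h1 : ∀ m, poissonMeasure n {m} * ∑ q ∈ Finset.HasAntidiagonal.antidiagonal m,
        (m.choose q.2 : ℝ≥0∞) * A (Finset.range q.1) (Finset.range q.2) =
      ∑' q : Finset.HasAntidiagonal.antidiagonal m, (n : ℝ≥0∞) ^ q.1.1 / (q.1.1.factorial : ℝ≥0∞) *
        poissonMeasure n {q.1.2} * A (Finset.range q.1.1) (Finset.range q.1.2) := by
    intro m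
    rw [Finset.mul_sum, Finset.tsum_subtype (Finset.HasAntidiagonal.antidiagonal m) (fun q : ℕ × ℕ =>
      (n : ℝ≥0∞) ^ q.1 / (q.1.factorial : ℝ≥0∞) * poissonMeasure n {q.2} *
        A (Finset.range q.1) (Finset.range q.2))]
    refine Finset.sum_congr rfl fun q hq => ?_
    rw [← Finset.HasAntidiagonal.mem_antidiagonal.1 hq, ← mul_assoc, poissonMeasure_singleton_mul_choose]
  simp_rw [h1]
  rw [← ENNReal.tsum_sigma' fun q : (Σ m : ℕ, Finset.HasAntidiagonal.antidiagonal m) =>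
      (n : ℝ≥0∞) ^ q.2.1.1 / (q.2.1.1.factorial : ℝ≥0∞) *
        poissonMeasure n {q.2.1.2} * A (Finset.range q.2.1.1) (Finset.range q.2.1.2),
    ← Finset.HasAntidiagonal.sigmaAntidiagonalEquivProd.symm.tsum_eq]
  simp only [Finset.HasAntidiagonal.sigmaAntidiagonalEquivProd_symm_apply_snd_coe]
  rw [ENNReal.tsum_prod']
  refine tsum_congr fun l => ?_
  simp only [mul_assoc]
  rw [ENNReal.tsum_mul_left]
  congr 1
  have h2 (y : ℕ → α) : ∫⁻ p, K y (Finset.range l) p.2 (Finset.range p.1) ∂poissonSample ν n =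
      ∑' j, poissonMeasure n {j} * ∫⁻ z, K y (Finset.range l) z (Finset.range j) ∂P :=
    lintegral_poissonSample ν n ((hmeas' l).comp measurable_prodMk_left)
  rw [lintegral_congr h2, lintegral_tsum]
  · refine tsum_congr fun j => ?_
    rw [hA_iter, lintegral_const_mul _
      (hK_meas (Finset.range l) (Finset.range j)).lintegral_prod_right']
  · exact fun j => ((hK_meas (Finset.range l) (Finset.range j)).lintegral_prod_right'.const_mul _).aemeasurable

end PoissonSplitting

/-! ### Thinning and the mean number of points in a set -/

section Thinning

variable {α : Type*} [MeasurableSpace α] (ν : Measure α) [IsProbabilityMeasure ν]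

lemma tsum_pow_div_factorial_mul_pow (n : ℝ≥0) {q : ℝ≥0∞} (hq : q ≠ ∞) :
    ∑' l : ℕ, (n : ℝ≥0∞) ^ l / (l.factorial : ℝ≥0∞) * q ^ l =
      ENNReal.ofReal (Real.exp (n * q.toReal)) := by
  lift q to ℝ≥0 using hq
  have h := NormedSpace.expSeries_div_hasSum_exp ((n : ℝ) * (q : ℝ))
  rw [← Real.exp_eq_exp_ℝ] at h
  rw [ENNReal.coe_toReal, ← h.tsum_eq,
    ENNReal.ofReal_tsum_of_nonneg (fun _ => by positivity) h.summable]
  refine tsum_congr fun l => ?_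
  rw [ENNReal.ofReal_div_of_pos (by positivity), ENNReal.ofReal_pow (by positivity),
    ENNReal.ofReal_natCast, ENNReal.ofReal_mul (by positivity), ENNReal.ofReal_coe_nnreal,
    ENNReal.ofReal_coe_nnreal, mul_pow, ENNReal.mul_div_right_comm]

open Classical in
/-- Deleting the points in `B` from a Poisson sample amounts to conditioning on `B` being void. -/
lemma lintegral_filter_poissonSample (n : ℝ≥0) {B : Set α} (hB : MeasurableSet B)
    (H : (ℕ → α) → Finset ℕ → ℝ≥0∞) (hH : ∀ T, Measurable fun x => H x T)
    (hH_perm : ∀ (τ : Equiv.Perm ℕ) z T, H (z ∘ τ) T = H z (T.map τ.toEmbedding))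
    (hH_congr : ∀ z z' T, (∀ i ∈ T, z i = z' i) → H z T = H z' T) :
    ∫⁻ p, H p.2 ((Finset.range p.1).filter fun i => p.2 i ∉ B) ∂poissonSample ν n =
      ENNReal.ofReal (Real.exp (n * (ν B).toReal)) *
        ∫⁻ p, (if ∀ j ∈ Finset.range p.1, p.2 j ∉ B then H p.2 (Finset.range p.1) else 0)
          ∂poissonSample ν n := by
  have hall (T : Finset ℕ) {C : Set α} (hC : MeasurableSet C) :
      MeasurableSet {x : ℕ → α | ∀ i ∈ T, x i ∈ C} := by
    simp only [Set.ofPred_forall]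
    exact Finset.measurableSet_biInter _ fun i _ => measurable_pi_apply i hC
  -- Only the split with all of `S` in `B` and all of `T` outside contributes. The `l` points in `B`
  -- carry weight `(n ν B)^l / l!`, which sums to the exponential.
  have key := lintegral_sum_powerset_poissonSample ν n
    (fun y S z T => if (∀ i ∈ S, y i ∈ B) ∧ ∀ j ∈ T, z j ∉ B then H z T else 0) ?_ ?_ ?_
  · have h1 (p : ℕ × (ℕ → α)) : ∑ T ∈ (Finset.range p.1).powerset,
        (if (∀ i ∈ Finset.range p.1 \ T, p.2 i ∈ B) ∧ ∀ j ∈ T, p.2 j ∉ B then H p.2 T else 0) =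
        H p.2 ((Finset.range p.1).filter fun i => p.2 i ∉ B) := by
      rw [Finset.sum_eq_single_of_mem ((Finset.range p.1).filter fun i => p.2 i ∉ B)
        (Finset.mem_powerset.2 (Finset.filter_subset _ _))]
      · rw [if_pos]
        simp +contextual
      · intro T hT hne
        rw [if_neg]
        rintro ⟨ha, hb⟩
        refine hne (Finset.ext fun i => ⟨fun hi => Finset.mem_filter.2
          ⟨Finset.mem_powerset.1 hT hi, hb i hi⟩, fun hi => ?_⟩)
        rw [Finset.mem_filter] at hi
        by_contra hiT
        exact hi.2 (ha i (Finset.mem_sdiff.2 ⟨hi.1, hiT⟩))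
    rw [lintegral_congr h1] at key
    rw [key, ← tsum_pow_div_factorial_mul_pow n (measure_ne_top ν B), ← ENNReal.tsum_mul_right]
    refine tsum_congr fun l => ?_
    rw [mul_assoc]
    congr 1
    have h2 (y : ℕ → α) : ∫⁻ p, (if (∀ i ∈ Finset.range l, y i ∈ B) ∧
          ∀ j ∈ Finset.range p.1, p.2 j ∉ B then H p.2 (Finset.range p.1) else 0)
          ∂poissonSample ν n =
        Set.indicator {y : ℕ → α | ∀ i ∈ Finset.range l, y i ∈ B} (fun _ =>
          ∫⁻ p, (if ∀ j ∈ Finset.range p.1, p.2 j ∉ B then H p.2 (Finset.range p.1) else 0)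
          ∂poissonSample ν n) y := by
      by_cases hy : ∀ i ∈ Finset.range l, y i ∈ B
      · rw [Set.indicator_of_mem (by exact hy)]
        simp only [eq_true hy, true_and]
      · rw [Set.indicator_of_notMem (by exact hy)]
        simp only [hy, false_and, if_false, lintegral_zero]
    rw [lintegral_congr h2, lintegral_indicator_const (hall _ hB), mul_comm]
    congr 1
    have h3 : {y : ℕ → α | ∀ i ∈ Finset.range l, y i ∈ B} =
        ((Finset.range l : Finset ℕ) : Set ℕ).pi fun _ => B := by
      ext y; simp [Set.mem_pi]
    rw [h3, Measure.infinitePi_pi _ fun _ _ => hB]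
    simp
  · intro S T
    refine Measurable.ite ?_ ((hH T).comp measurable_snd) measurable_const
    exact (measurable_fst (hall S hB)).inter (measurable_snd (hall T hB.compl))
  · intro σ τ y S z T
    simp only [Finset.forall_mem_map, hH_perm]
    rfl
  · intro y y' S z z' T hS hT
    rw [hH_congr z z' T hT]
    congr 1
    refine propext (and_congr (forall₂_congr fun i hi => by rw [hS i hi])
      (forall₂_congr fun i hi => by rw [hT i hi]))

open Classical in
/-- The expected number of points of a Poisson sample in a set. -/
lemma lintegral_card_filter_poissonSample (n : ℝ≥0) {B : Set α} (hB : MeasurableSet B) :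
    ∫⁻ p, (((Finset.range p.1).filter fun i => p.2 i ∈ B).card : ℝ≥0∞) ∂poissonSample ν n =
      n * ν B := by
  have hall (T : Finset ℕ) {C : Set α} (hC : MeasurableSet C) :
      MeasurableSet {x : ℕ → α | ∀ i ∈ T, x i ∈ C} := by
    simp only [Set.ofPred_forall]
    exact Finset.measurableSet_biInter _ fun i _ => measurable_pi_apply i hC
  -- The functional picks out a single point lying in `B`, so only the term `l = 1` survives.
  have key := lintegral_sum_powerset_poissonSample ν n
    (fun y S _ _ => if S.card = 1 ∧ ∀ i ∈ S, y i ∈ B then 1 else 0) ?_ ?_ ?_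
  · have h1 (p : ℕ × (ℕ → α)) : ∑ T ∈ (Finset.range p.1).powerset,
        (if (Finset.range p.1 \ T).card = 1 ∧ ∀ i ∈ Finset.range p.1 \ T, p.2 i ∈ B
          then 1 else 0 : ℝ≥0∞) =
        (((Finset.range p.1).filter fun i => p.2 i ∈ B).card : ℝ≥0∞) := by
      have h2 : ∑ T ∈ (Finset.range p.1).powerset,
          (if (Finset.range p.1 \ T).card = 1 ∧ ∀ i ∈ Finset.range p.1 \ T, p.2 i ∈ B
          then 1 else 0 : ℝ≥0∞) = ∑ S ∈ (Finset.range p.1).powerset,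
          (if S.card = 1 ∧ ∀ i ∈ S, p.2 i ∈ B then 1 else 0 : ℝ≥0∞) := by
        refine Finset.sum_nbij' (fun T => Finset.range p.1 \ T) (fun T => Finset.range p.1 \ T)
          (by simp) (by simp) ?_ ?_ (fun _ _ => rfl) <;>
        · intro T hT
          exact Finset.sdiff_sdiff_eq_self (Finset.mem_powerset.1 hT)
      rw [h2, ← Finset.sum_filter, Finset.sum_const, nsmul_one, Nat.cast_inj]
      refine (Finset.card_bij (fun i _ => {i}) ?_ (by simp) ?_).symm
      · intro i hi
        simpa using hi
      · intro S hS
        simp only [Finset.mem_filter, Finset.mem_powerset] at hS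
        obtain ⟨i, rfl⟩ := Finset.card_eq_one.1 hS.2.1
        exact ⟨i, by simpa using hS, rfl⟩
    rw [lintegral_congr h1] at key
    rw [key, tsum_eq_single 1]
    · have h3 (y : ℕ → α) : (if (Finset.range 1).card = 1 ∧ ∀ i ∈ Finset.range 1, y i ∈ B
          then 1 else 0 : ℝ≥0∞) = Set.indicator ((fun y : ℕ → α => y 0) ⁻¹' B) 1 y := by
        simp [Set.indicator_apply]
      simp only [lintegral_const, measure_univ, mul_one, h3]
      rw [lintegral_indicator_one (measurable_pi_apply 0 hB),
        (measurePreserving_eval_infinitePi (fun _ : ℕ => ν) 0).measure_preimage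
          hB.nullMeasurableSet]
      simp
    · intro l hl
      simp [hl]
  · intro S T
    refine Measurable.ite ?_ measurable_const measurable_const
    exact (MeasurableSet.const _).inter (measurable_fst (hall S hB))
  · intro σ τ y S z T
    simp only [Finset.forall_mem_map, Finset.card_map]
    rfl
  · intro y y' S z z' T hS hT
    congr 1
    exact propext (and_congr_right fun _ => forall₂_congr fun i hi => by rw [hS i hi])

end Thinning

/-! ### Measurability and the size-bias identity -/

section SizeBias

variable {d k : ℕ} {r : ℝ}

/-- Compactness: along a convergent sequence of configurations the common points stay bounded, and a
subsequential limit is a common point of the limiting balls. This supplies measurability despite the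
uncountable existential. -/
lemma isClosed_setOf_nonempty_iInter_closedBall (r : ℝ) {s : Finset ℕ} (hs : s.Nonempty) :
    IsClosed {x : ℕ → EuclideanSpace ℝ (Fin d) |
      (⋂ i ∈ s, Metric.closedBall (x i) r).Nonempty} := by
  refine IsSeqClosed.isClosed fun u x hu hx => ?_
  choose v hv using hu
  simp only [Set.mem_iInter, Metric.mem_closedBall] at hv
  obtain ⟨i₀, hi₀⟩ := hs
  have hxi (i : ℕ) : Tendsto (fun n => u n i) atTop (𝓝 (x i)) := (tendsto_pi_nhds.1 hx) i
  have hbd : Bornology.IsBounded (Set.range v) := by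
    obtain ⟨R, hR⟩ := (Metric.isBounded_range_of_tendsto _ (hxi i₀)).subset_closedBall 0
    refine (Metric.isBounded_closedBall (x := (0 : EuclideanSpace ℝ (Fin d)))
      (r := r + R)).subset ?_
    rintro _ ⟨n, rfl⟩
    have h1 := hv n i₀ hi₀
    have h2 := Metric.mem_closedBall.1 (hR ⟨n, rfl⟩)
    rw [Metric.mem_closedBall]
    linarith [dist_triangle (v n) (u n i₀) 0]
  obtain ⟨a, -, φ, hφ, ha⟩ := tendsto_subseq_of_bounded hbd fun n => Set.mem_range_self n
  refine ⟨a, ?_⟩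
  simp only [Set.mem_iInter, Metric.mem_closedBall]
  exact fun i hi => le_of_tendsto (ha.dist ((hxi i).comp hφ.tendsto_atTop))
    (Eventually.of_forall fun n => hv (φ n) i hi)

lemma measurableSet_nonempty_iInter_closedBall (r : ℝ) (s : Finset ℕ) :
    MeasurableSet {x : ℕ → EuclideanSpace ℝ (Fin d) |
      (⋂ i ∈ s, Metric.closedBall (x i) r).Nonempty} := by
  rcases s.eq_empty_or_nonempty with rfl | hs
  · simp
  · exact (isClosed_setOf_nonempty_iInter_closedBall r hs).measurableSet

lemma measurableSet_isEmptySimplex (r : ℝ) (s : Finset ℕ) :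
    MeasurableSet {x : ℕ → EuclideanSpace ℝ (Fin d) | IsEmptySimplex r x s} := by
  have : {x : ℕ → EuclideanSpace ℝ (Fin d) | IsEmptySimplex r x s} =
      (⋂ j ∈ s, {x | (⋂ i ∈ s.erase j, Metric.closedBall (x i) r).Nonempty}) ∩
        {x | (⋂ i ∈ s, Metric.closedBall (x i) r).Nonempty}ᶜ := by
    ext x
    simp only [IsEmptySimplex, Set.mem_inter_iff, Set.mem_iInter, Set.mem_compl_iff,
      Set.mem_ofPred_eq, Set.not_nonempty_iff_eq_empty]
  rw [this]
  exact (Finset.measurableSet_biInter _ fun j _ =>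
    measurableSet_nonempty_iInter_closedBall r _).inter
    (measurableSet_nonempty_iInter_closedBall r _).compl

lemma measurable_card_isolatedSimplices (k : ℕ) (r : ℝ) (t : Finset ℕ) :
    Measurable fun x : ℕ → EuclideanSpace ℝ (Fin d) => (isolatedSimplices k r x t).card := by
  classical
  have (x : ℕ → EuclideanSpace ℝ (Fin d)) : (isolatedSimplices k r x t).card =
      ∑ s ∈ t.powersetCard k, if x ∈ {x | IsEmptySimplex r x s} ∩
        ⋂ i ∈ s, ⋂ j ∈ t \ s, {x | dist (x i) (x j) ≤ 2 * r}ᶜ then 1 else 0 := by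
    rw [isolatedSimplices, Finset.card_filter]
    refine Finset.sum_congr rfl fun s _ => ?_
    congr 1
    simp only [Set.mem_inter_iff, Set.mem_iInter, Set.mem_compl_iff, Set.mem_ofPred_eq]
  simp_rw [this]
  refine Finset.measurable_fun_sum _ fun s _ => Measurable.ite ?_ measurable_const measurable_const
  refine (measurableSet_isEmptySimplex r s).inter (Finset.measurableSet_biInter _ fun i _ =>
    Finset.measurableSet_biInter _ fun j _ => MeasurableSet.compl ?_)
  exact measurableSet_le (by fun_prop) measurable_const

/-- The points within distance `2 * r` of the points `y i`, `i ∈ S`. -/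
def nearSet (r : ℝ) (y : ℕ → EuclideanSpace ℝ (Fin d)) (S : Finset ℕ) :
    Set (EuclideanSpace ℝ (Fin d)) := {v | ∃ i ∈ S, dist (y i) v ≤ 2 * r}

lemma measurableSet_nearSet_prod (r : ℝ) (S : Finset ℕ) :
    MeasurableSet {p : (ℕ → EuclideanSpace ℝ (Fin d)) × EuclideanSpace ℝ (Fin d) |
      p.2 ∈ nearSet r p.1 S} := by
  have : {p : (ℕ → EuclideanSpace ℝ (Fin d)) × EuclideanSpace ℝ (Fin d) |
      p.2 ∈ nearSet r p.1 S} = ⋃ i ∈ S, {p | dist (p.1 i) p.2 ≤ 2 * r} := by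
    ext p; simp [nearSet]
  rw [this]
  exact Finset.measurableSet_biUnion _ fun i _ =>
    measurableSet_le (by fun_prop) measurable_const

lemma measurableSet_nearSet (r : ℝ) (y : ℕ → EuclideanSpace ℝ (Fin d)) (S : Finset ℕ) :
    MeasurableSet (nearSet r y S) :=
  measurable_prodMk_left (measurableSet_nearSet_prod r S)

open Classical in
/-- The number of isolated empty simplices left after deleting the points near `y 0, …, y (k-1)`. -/
noncomputable def thinnedCount (k : ℕ) (r : ℝ) (y x : ℕ → EuclideanSpace ℝ (Fin d)) (m : ℕ) : ℕ :=
  (isolatedSimplices k r x ((Finset.range m).filter fun i =>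
    x i ∉ nearSet r y (Finset.range k))).card

/-- The set of surviving indices is random, so the count is written as a finite sum over its
possible values. -/
lemma measurable_thinnedCount (k : ℕ) (r : ℝ) :
    Measurable fun p : (ℕ → EuclideanSpace ℝ (Fin d)) × (ℕ × (ℕ → EuclideanSpace ℝ (Fin d))) =>
      thinnedCount k r p.1 p.2.2 p.2.1 := by
  classical
  have h : Measurable fun q : ℕ × ((ℕ → EuclideanSpace ℝ (Fin d)) ×
      (ℕ → EuclideanSpace ℝ (Fin d))) => thinnedCount k r q.2.1 q.2.2 q.1 := by
    refine measurable_from_prod_countable_right fun m => ?_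
    have (p : (ℕ → EuclideanSpace ℝ (Fin d)) × (ℕ → EuclideanSpace ℝ (Fin d))) :
        thinnedCount k r p.1 p.2 m = ∑ T ∈ (Finset.range m).powerset,
          if p ∈ ⋂ i ∈ Finset.range m, {p | i ∈ T ↔ p.2 i ∉ nearSet r p.1 (Finset.range k)} then
            (isolatedSimplices k r p.2 T).card else 0 := by
      rw [Finset.sum_eq_single_of_mem ((Finset.range m).filter fun i =>
        p.2 i ∉ nearSet r p.1 (Finset.range k)) (Finset.mem_powerset.2 (Finset.filter_subset _ _))]
      · rw [if_pos, thinnedCount]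
        simp +contextual
      · intro T hT hne
        rw [if_neg]
        intro hp
        simp only [Set.mem_iInter, Set.mem_ofPred_eq] at hp
        refine hne (Finset.ext fun i => ?_)
        rw [Finset.mem_filter]
        exact ⟨fun hi => ⟨Finset.mem_powerset.1 hT hi, (hp i (Finset.mem_powerset.1 hT hi)).1 hi⟩,
          fun hi => (hp i hi.1).2 hi.2⟩
    simp only [this]
    refine Finset.measurable_fun_sum _ fun T _ => Measurable.ite
      (Finset.measurableSet_biInter _ fun i _ => ?_)
      ((measurable_card_isolatedSimplices k r T).comp measurable_snd) measurable_const
    have hm : MeasurableSet {p : (ℕ → EuclideanSpace ℝ (Fin d)) × (ℕ → EuclideanSpace ℝ (Fin d)) |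
        p.2 i ∈ nearSet r p.1 (Finset.range k)} :=
      (show Measurable fun p : (ℕ → EuclideanSpace ℝ (Fin d)) × (ℕ → EuclideanSpace ℝ (Fin d)) =>
        (p.1, p.2 i) by fun_prop) (measurableSet_nearSet_prod r (Finset.range k))
    by_cases hi : i ∈ T
    · simp only [hi, true_iff]
      exact hm.compl
    · simp only [hi, false_iff, not_not]
      exact hm
  exact h.comp (f := fun q : (ℕ → EuclideanSpace ℝ (Fin d)) × (ℕ × (ℕ →
    EuclideanSpace ℝ (Fin d))) => (q.2.1, (q.1, q.2.2))) (by fun_prop)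

lemma measurable_isolatedCount (k : ℕ) (r : ℝ) :
    Measurable fun p : ℕ × (ℕ → EuclideanSpace ℝ (Fin d)) => isolatedCount k r p.2 p.1 := by
  refine measurable_from_prod_countable_right fun m => ?_
  simp only [isolatedCount_eq_card]
  exact measurable_card_isolatedSimplices k r _

variable (ν : Measure (EuclideanSpace ℝ (Fin d))) [IsProbabilityMeasure ν]

open Classical in
/-- The density, with respect to the law of a sequence of independent points, of the expected number
of isolated empty simplices in a Poisson sample. -/
noncomputable def simplexIntensity (k : ℕ) (r : ℝ) (n : ℝ≥0)
    (y : ℕ → EuclideanSpace ℝ (Fin d)) : ℝ≥0 :=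
  if IsEmptySimplex r y (Finset.range k) then
    n ^ k / k.factorial *
      Real.toNNReal (Real.exp (-(n * (ν (nearSet r y (Finset.range k))).toReal))) else 0

lemma measurable_simplexIntensity (k : ℕ) (r : ℝ) (n : ℝ≥0) :
    Measurable (simplexIntensity ν k r n) := by
  classical
  have h : Measurable fun y : ℕ → EuclideanSpace ℝ (Fin d) =>
      ν (nearSet r y (Finset.range k)) :=
    measurable_measure_prodMk_left (measurableSet_nearSet_prod r (Finset.range k))
  refine Measurable.ite (measurableSet_isEmptySimplex r _) ?_ measurable_const
  have := h.ennreal_toReal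
  fun_prop

/-- Size-bias identity: an isolated empty simplex chosen from a Poisson sample looks like a fixed
one, the remaining points being a Poisson sample without the points near it. -/
theorem lintegral_isolatedCount_mul (hk : 3 ≤ k) (n : ℝ≥0) (f : ℕ → ℝ≥0∞) :
    ∫⁻ p, (isolatedCount k r p.2 p.1 : ℝ≥0∞) * f (isolatedCount k r p.2 p.1)
        ∂poissonSample ν n =
      ∫⁻ y, simplexIntensity ν k r n y *
        ∫⁻ p, f (1 + thinnedCount k r y p.2 p.1) ∂poissonSample ν n
          ∂Measure.infinitePi fun _ => ν := by
  classical
  set H : (ℕ → EuclideanSpace ℝ (Fin d)) → Finset ℕ → ℝ≥0∞ := fun z T =>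
    f (1 + (isolatedSimplices k r z T).card) with hH
  have hf : Measurable f := measurable_from_top
  have hHm (T : Finset ℕ) : Measurable fun x => H x T :=
    hf.comp (measurable_const.add (measurable_card_isolatedSimplices k r T))
  have hH_perm (τ : Equiv.Perm ℕ) (z T) : H (z ∘ τ) T = H z (T.map τ.toEmbedding) := by
    simp only [hH, card_isolatedSimplices_comp_perm]
  have hH_congr (z z' T) (h : ∀ i ∈ T, z i = z' i) : H z T = H z' T := by
    simp only [hH, isolatedSimplices_congr h]
  have hnear_perm (σ : Equiv.Perm ℕ) (y : ℕ → EuclideanSpace ℝ (Fin d)) (S : Finset ℕ) :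
      nearSet r (y ∘ σ) S = nearSet r y (S.map σ.toEmbedding) := by
    ext v
    constructor
    · rintro ⟨i, hi, h⟩
      exact ⟨σ i, Finset.mem_map_of_mem _ hi, h⟩
    · rintro ⟨_, hi, h⟩
      obtain ⟨i, hi', rfl⟩ := Finset.mem_map.1 hi
      exact ⟨i, hi', h⟩
  have hnear_congr (y y' : ℕ → EuclideanSpace ℝ (Fin d)) (S : Finset ℕ)
      (h : ∀ i ∈ S, y i = y' i) : nearSet r y S = nearSet r y' S := by
    ext v
    exact exists_congr fun i => and_congr_right fun hi => by rw [h i hi]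
  -- `S` is the chosen isolated simplex and `T` the rest of the sample. On this event the total
  -- count is one plus the count in `T`, so the value is `f` of the total.
  have key := lintegral_sum_powerset_poissonSample ν n
    (fun y S z T => if (S.card = k ∧ IsEmptySimplex r y S) ∧ ∀ j ∈ T, z j ∉ nearSet r y S
      then H z T else 0) ?_ ?_ ?_
  · have h1 (p : ℕ × (ℕ → EuclideanSpace ℝ (Fin d))) : ∑ T ∈ (Finset.range p.1).powerset,
        (if ((Finset.range p.1 \ T).card = k ∧ IsEmptySimplex r p.2 (Finset.range p.1 \ T)) ∧
          ∀ j ∈ T, p.2 j ∉ nearSet r p.2 (Finset.range p.1 \ T) then H p.2 T else 0) =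
        (isolatedCount k r p.2 p.1 : ℝ≥0∞) * f (isolatedCount k r p.2 p.1) := by
      have h2 : ∑ T ∈ (Finset.range p.1).powerset,
          (if ((Finset.range p.1 \ T).card = k ∧ IsEmptySimplex r p.2 (Finset.range p.1 \ T)) ∧
            ∀ j ∈ T, p.2 j ∉ nearSet r p.2 (Finset.range p.1 \ T) then H p.2 T else 0) =
          ∑ S ∈ (Finset.range p.1).powerset, (if (S.card = k ∧ IsEmptySimplex r p.2 S) ∧
            ∀ j ∈ Finset.range p.1 \ S, p.2 j ∉ nearSet r p.2 S then
              H p.2 (Finset.range p.1 \ S) else 0) := by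
        refine Finset.sum_nbij' (fun T => Finset.range p.1 \ T) (fun T => Finset.range p.1 \ T)
          (by simp) (by simp) ?_ ?_ ?_
        · intro T hT
          exact Finset.sdiff_sdiff_eq_self (Finset.mem_powerset.1 hT)
        · intro T hT
          exact Finset.sdiff_sdiff_eq_self (Finset.mem_powerset.1 hT)
        · intro T hT
          simp only [Finset.sdiff_sdiff_eq_self (Finset.mem_powerset.1 hT)]
      rw [h2, ← Finset.sum_filter]
      have h3 : (Finset.range p.1).powerset.filter (fun S => (S.card = k ∧
          IsEmptySimplex r p.2 S) ∧ ∀ j ∈ Finset.range p.1 \ S, p.2 j ∉ nearSet r p.2 S) =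
          isolatedSimplices k r p.2 (Finset.range p.1) := by
        ext S
        simp only [Finset.mem_filter, Finset.mem_powerset, mem_isolatedSimplices, nearSet,
          Set.mem_ofPred_eq, Finset.mem_sdiff]
        constructor
        · rintro ⟨a, ⟨b, c⟩, e⟩
          exact ⟨⟨a, b⟩, c, fun i hi j hj hjs hij => e j ⟨hj, hjs⟩ ⟨i, hi, hij⟩⟩
        · rintro ⟨⟨a, b⟩, c, e⟩
          exact ⟨a, ⟨b, c⟩, fun j hj ⟨i, hi, hij⟩ => e i hi j hj.1 hj.2 hij⟩
      rw [h3, isolatedCount_eq_card, Finset.sum_congr rfl fun S hS => show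
        H p.2 (Finset.range p.1 \ S) =
          f (isolatedSimplices k r p.2 (Finset.range p.1)).card by
        rw [card_isolatedSimplices_sdiff hk hS], Finset.sum_const, nsmul_eq_mul]
    rw [lintegral_congr h1] at key
    rw [key, tsum_eq_single k]
    · rw [← lintegral_const_mul']
      · refine lintegral_congr fun y => ?_
        by_cases hy : IsEmptySimplex r y (Finset.range k)
        · have h4 := lintegral_filter_poissonSample ν n
            (measurableSet_nearSet r y (Finset.range k)) H hHm hH_perm hH_congr
          simp only [Finset.card_range, eq_true hy, true_and, simplexIntensity, if_true]
          have h5 : ∫⁻ p, f (1 + thinnedCount k r y p.2 p.1) ∂poissonSample ν n = _ := h4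
          rw [h5, ← mul_assoc]
          congr 1
          rw [ENNReal.coe_mul, ENNReal.coe_div (by positivity), mul_assoc]
          have h6 (a : ℝ) : ((Real.exp (-a)).toNNReal : ℝ≥0∞) * ENNReal.ofReal (Real.exp a) = 1 := by
            rw [← ENNReal.ofReal, ← ENNReal.ofReal_mul (by positivity), ← Real.exp_add]
            simp
          rw [h6]
          simp
        · simp [hy, simplexIntensity]
      · exact ENNReal.div_ne_top (by simp) (by positivity)
    · intro l hl
      simp [hl]
  · intro S T
    refine Measurable.ite ?_ ((hHm T).comp measurable_snd) measurable_const
    refine MeasurableSet.inter ((MeasurableSet.const _).inter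
      (measurable_fst (measurableSet_isEmptySimplex r S))) ?_
    have : {p : (ℕ → EuclideanSpace ℝ (Fin d)) × (ℕ → EuclideanSpace ℝ (Fin d)) |
        ∀ j ∈ T, p.2 j ∉ nearSet r p.1 S} = ⋂ j ∈ T, {p | p.2 j ∈ nearSet r p.1 S}ᶜ := by
      ext p; simp only [Set.mem_iInter, Set.mem_compl_iff, Set.mem_ofPred_eq]
    refine MeasurableSet.congr ?_ this.symm
    refine Finset.measurableSet_biInter _ fun j _ => MeasurableSet.compl ?_
    exact (show Measurable fun p : (ℕ → EuclideanSpace ℝ (Fin d)) × (ℕ →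
      EuclideanSpace ℝ (Fin d)) => (p.1, p.2 j) by fun_prop) (measurableSet_nearSet_prod r S)
  · intro σ τ y S z T
    simp only [Finset.forall_mem_map, hH_perm, Finset.card_map, isEmptySimplex_comp_perm,
      hnear_perm]
    rfl
  · intro y y' S z z' T hS hT
    rw [hH_congr z z' T hT, isEmptySimplex_congr hS, hnear_congr y y' S hS]
    congr 1
    exact propext (and_congr_right fun _ => forall₂_congr fun i hi => by rw [hT i hi])

end SizeBias

/-! ### Approximate Stein identity, second moment and lower bound for the mean -/

section SteinBound

variable {d k : ℕ} {r : ℝ} (ν : Measure (EuclideanSpace ℝ (Fin d))) [IsProbabilityMeasure ν]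

/-- The joint law of a simplex weighted by its expected multiplicity and an independent Poisson
sample. -/
noncomputable def simplexSample (k : ℕ) (r : ℝ) (n : ℝ≥0) :
    Measure ((ℕ → EuclideanSpace ℝ (Fin d)) × (ℕ × (ℕ → EuclideanSpace ℝ (Fin d)))) :=
  ((Measure.infinitePi fun _ => ν).withDensity fun y => (simplexIntensity ν k r n y : ℝ≥0∞)).prod
    (poissonSample ν n)

omit [IsProbabilityMeasure ν] in
lemma simplexIntensity_le (k : ℕ) (r : ℝ) (n : ℝ≥0) (y : ℕ → EuclideanSpace ℝ (Fin d)) :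
    simplexIntensity ν k r n y ≤ n ^ k / k.factorial := by
  unfold simplexIntensity
  split_ifs
  · refine mul_le_of_le_one_right (by positivity) ?_
    rw [Real.toNNReal_le_one, Real.exp_le_one_iff, neg_nonpos]
    positivity
  · positivity

lemma lintegral_isolatedCount (hk : 3 ≤ k) (n : ℝ≥0) :
    ∫⁻ p, (isolatedCount k r p.2 p.1 : ℝ≥0∞) ∂poissonSample ν n =
      ∫⁻ y, simplexIntensity ν k r n y ∂Measure.infinitePi fun _ => ν := by
  simpa using lintegral_isolatedCount_mul (r := r) ν hk n fun _ => 1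

lemma lintegral_isolatedCount_lt_top (hk : 3 ≤ k) (n : ℝ≥0) :
    ∫⁻ p, (isolatedCount k r p.2 p.1 : ℝ≥0∞) ∂poissonSample ν n < ∞ := by
  rw [lintegral_isolatedCount ν hk]
  calc ∫⁻ y, simplexIntensity ν k r n y ∂Measure.infinitePi (fun _ => ν)
      ≤ ∫⁻ y, ((n ^ k / k.factorial : ℝ≥0) : ℝ≥0∞) ∂Measure.infinitePi (fun _ : ℕ => ν) :=
        lintegral_mono fun y => ENNReal.coe_le_coe.2 (simplexIntensity_le ν k r n y)
    _ < ∞ := by rw [lintegral_const, measure_univ, mul_one]; exact ENNReal.coe_lt_top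

lemma withDensity_simplexIntensity_univ (hk : 3 ≤ k) (n : ℝ≥0) :
    ((Measure.infinitePi fun _ => ν).withDensity
      fun y => (simplexIntensity ν k r n y : ℝ≥0∞)) Set.univ =
      ∫⁻ p, (isolatedCount k r p.2 p.1 : ℝ≥0∞) ∂poissonSample ν n := by
  rw [withDensity_apply _ .univ, setLIntegral_univ, lintegral_isolatedCount ν hk]

lemma isFiniteMeasure_withDensity_simplexIntensity (hk : 3 ≤ k) (n : ℝ≥0) :
    IsFiniteMeasure ((Measure.infinitePi fun _ => ν).withDensity
      fun y => (simplexIntensity ν k r n y : ℝ≥0∞)) :=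
  ⟨by rw [withDensity_simplexIntensity_univ ν hk]; exact lintegral_isolatedCount_lt_top ν hk n⟩

lemma lintegral_simplexSample (n : ℝ≥0)
    {F : (ℕ → EuclideanSpace ℝ (Fin d)) × (ℕ × (ℕ → EuclideanSpace ℝ (Fin d))) → ℝ≥0∞}
    (hF : Measurable F) :
    ∫⁻ q, F q ∂simplexSample ν k r n = ∫⁻ y, simplexIntensity ν k r n y *
      ∫⁻ p, F (y, p) ∂poissonSample ν n ∂Measure.infinitePi fun _ => ν := by
  rw [simplexSample, lintegral_prod _ hF.aemeasurable, lintegral_withDensity_eq_lintegral_mul _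
    (measurable_simplexIntensity ν k r n).coe_nnreal_ennreal hF.lintegral_prod_right']
  rfl

lemma nearSet_subset_closedBall (hk : 3 ≤ k) {y : ℕ → EuclideanSpace ℝ (Fin d)}
    (hy : IsEmptySimplex r y (Finset.range k)) {v : EuclideanSpace ℝ (Fin d)}
    (hv : v ∈ nearSet r y (Finset.range k)) : dist v (y 0) ≤ 4 * r := by
  obtain ⟨i, hi, hiv⟩ := hv
  have := hy.dist_le (by simpa using hk) hi (Finset.mem_range.2 (by omega : 0 < k))
  have := dist_triangle_left v (y 0) (y i)
  linarith

/-- The radius is three steps of `2r`: from `y 0` to another vertex, to a deleted point, and to a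
point whose isolation that deletion may change. -/
lemma abs_isolatedCount_sub_thinnedCount_le (hk : 3 ≤ k) (hr : 0 ≤ r)
    {y : ℕ → EuclideanSpace ℝ (Fin d)} (hy : IsEmptySimplex r y (Finset.range k))
    (x : ℕ → EuclideanSpace ℝ (Fin d)) (m : ℕ) [DecidablePred fun i =>
      x i ∈ Metric.closedBall (y 0) (6 * r)] :
    |(isolatedCount k r x m : ℝ) - thinnedCount k r y x m| ≤
      2 * ((Finset.range m).filter fun i => x i ∈ Metric.closedBall (y 0) (6 * r)).card := by
  classical
  have := abs_card_isolatedSimplices_sub_le hk hr x (Finset.range m)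
    (nearSet r y (Finset.range k)) (Metric.closedBall (y 0) (6 * r)) fun v w hv hvw => by
      have := nearSet_subset_closedBall hk hy hv
      have := dist_triangle w v (y 0)
      rw [Metric.mem_closedBall]
      linarith
  rw [isolatedCount_eq_card, thinnedCount]
  convert this

lemma measurable_isolatedCount_snd (k : ℕ) (r : ℝ) :
    Measurable fun q : (ℕ → EuclideanSpace ℝ (Fin d)) × (ℕ × (ℕ → EuclideanSpace ℝ (Fin d))) =>
      isolatedCount k r q.2.2 q.2.1 := (measurable_isolatedCount k r).comp measurable_snd

/-- For each fixed simplex the mean change is at most `2ρ`, by counting points in a ball;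
integrating against the intensity multiplies this by the mean count. -/
lemma lintegral_enorm_isolatedCount_sub_thinnedCount_le (hk : 3 ≤ k) (hr : 0 ≤ r) (n ρ : ℝ≥0)
    (hρ : ∀ v, n * ν (Metric.closedBall v (6 * r)) ≤ ρ) :
    ∫⁻ q, ‖(isolatedCount k r q.2.2 q.2.1 : ℝ) - thinnedCount k r q.1 q.2.2 q.2.1‖ₑ
        ∂simplexSample ν k r n ≤
      2 * ρ * ∫⁻ p, (isolatedCount k r p.2 p.1 : ℝ≥0∞) ∂poissonSample ν n := by
  classical
  have hD : Measurable fun q : (ℕ → EuclideanSpace ℝ (Fin d)) × (ℕ × (ℕ →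
      EuclideanSpace ℝ (Fin d))) =>
      ‖(isolatedCount k r q.2.2 q.2.1 : ℝ) - thinnedCount k r q.1 q.2.2 q.2.1‖ₑ :=
    ((measurable_from_top.comp (measurable_isolatedCount_snd k r)).sub
      (measurable_from_top.comp (measurable_thinnedCount k r))).enorm
  rw [lintegral_simplexSample ν n hD,
    lintegral_isolatedCount ν hk, ← lintegral_const_mul' _ _ (by finiteness)]
  refine lintegral_mono fun y => ?_
  by_cases hy : IsEmptySimplex r y (Finset.range k)
  · rw [mul_comm]
    gcongr
    calc ∫⁻ p, ‖(isolatedCount k r p.2 p.1 : ℝ) - thinnedCount k r y p.2 p.1‖ₑ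
          ∂poissonSample ν n
        ≤ ∫⁻ p, 2 * (((Finset.range p.1).filter fun i =>
            p.2 i ∈ Metric.closedBall (y 0) (6 * r)).card : ℝ≥0∞) ∂poissonSample ν n := by
          refine lintegral_mono fun p => ?_
          rw [Real.enorm_eq_ofReal_abs]
          refine (ENNReal.ofReal_le_ofReal
            (abs_isolatedCount_sub_thinnedCount_le hk hr hy p.2 p.1)).trans ?_
          rw [ENNReal.ofReal_mul (by norm_num), ENNReal.ofReal_natCast]
          simp
      _ ≤ 2 * ρ := by
          rw [lintegral_const_mul' _ _ (by finiteness),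
            lintegral_card_filter_poissonSample ν n Metric.isClosed_closedBall.measurableSet]
          gcongr
          exact hρ _
  · simp [simplexIntensity, hy]

lemma integrable_isolatedCount_sub_thinnedCount (hk : 3 ≤ k) (hr : 0 ≤ r) (n : ℝ≥0) :
    Integrable (fun q => (isolatedCount k r q.2.2 q.2.1 : ℝ) - thinnedCount k r q.1 q.2.2 q.2.1)
      (simplexSample ν k r n) := by
  have hc : Measurable fun a : ℕ => (a : ℝ) := measurable_from_top
  refine ⟨((hc.comp (measurable_isolatedCount_snd k r)).sub
    (hc.comp (measurable_thinnedCount k r))).aestronglyMeasurable, ?_⟩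
  -- Only finiteness is needed, so the crude bound `ρ = n` is enough.
  refine (lintegral_enorm_isolatedCount_sub_thinnedCount_le ν hk hr n n fun v => ?_).trans_lt ?_
  · exact mul_le_of_le_one_right zero_le prob_le_one
  · exact ENNReal.mul_lt_top (by finiteness) (lintegral_isolatedCount_lt_top ν hk n)

lemma integrable_isolatedCount (hk : 3 ≤ k) (n : ℝ≥0) :
    Integrable (fun p => (isolatedCount k r p.2 p.1 : ℝ)) (poissonSample ν n) := by
  have hc : Measurable fun a : ℕ => (a : ℝ) := measurable_from_top
  refine ⟨(hc.comp (measurable_isolatedCount k r)).aestronglyMeasurable, ?_⟩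
  simpa [HasFiniteIntegral, Real.enorm_natCast] using
    lintegral_isolatedCount_lt_top (r := r) ν hk n

lemma ofReal_integral_isolatedCount (hk : 3 ≤ k) (n : ℝ≥0) :
    ENNReal.ofReal (∫ p, (isolatedCount k r p.2 p.1 : ℝ) ∂poissonSample ν n) =
      ∫⁻ p, (isolatedCount k r p.2 p.1 : ℝ≥0∞) ∂poissonSample ν n := by
  rw [ofReal_integral_eq_lintegral_ofReal (integrable_isolatedCount ν hk n)
    (ae_of_all _ fun p => Nat.cast_nonneg _)]
  simp

lemma integrable_isolatedCount_snd (hk : 3 ≤ k) (n : ℝ≥0) :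
    Integrable (fun q => (isolatedCount k r q.2.2 q.2.1 : ℝ)) (simplexSample ν k r n) := by
  have := isFiniteMeasure_withDensity_simplexIntensity (r := r) ν hk n
  exact (integrable_isolatedCount ν hk n).comp_snd _

lemma integrable_thinnedCount (hk : 3 ≤ k) (hr : 0 ≤ r) (n : ℝ≥0) :
    Integrable (fun q => (thinnedCount k r q.1 q.2.2 q.2.1 : ℝ)) (simplexSample ν k r n) := by
  refine ((integrable_isolatedCount_snd ν hk n).sub
    (integrable_isolatedCount_sub_thinnedCount ν hk hr n)).congr (ae_of_all _ fun q => ?_)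
  simp

/-- The isolated count is square integrable. -/
theorem memLp_two_isolatedCount (hk : 3 ≤ k) (hr : 0 ≤ r) (n : ℝ≥0) :
    MemLp (fun p => (isolatedCount k r p.2 p.1 : ℝ)) 2 (poissonSample ν n) := by
  have hWr : Measurable fun p : ℕ × (ℕ → EuclideanSpace ℝ (Fin d)) =>
      (isolatedCount k r p.2 p.1 : ℝ) := measurable_from_top.comp (measurable_isolatedCount k r)
  have := isFiniteMeasure_withDensity_simplexIntensity (r := r) ν hk n
  have : IsFiniteMeasure (simplexSample ν k r n) := by unfold simplexSample; infer_instance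
  rw [memLp_two_iff_integrable_sq hWr.aestronglyMeasurable]
  refine ⟨(hWr.pow_const 2).aestronglyMeasurable, ?_⟩
  have h1 : ∀ p : ℕ × (ℕ → EuclideanSpace ℝ (Fin d)), ‖(isolatedCount k r p.2 p.1 : ℝ) ^ 2‖ₑ =
      (isolatedCount k r p.2 p.1 : ℝ≥0∞) * (isolatedCount k r p.2 p.1 : ℝ≥0∞) := fun p => by
    rw [enorm_pow, Real.enorm_natCast, sq]
  have h2 := ((integrable_const (1 : ℝ)).add (integrable_thinnedCount ν hk hr n)).2
  -- The size-bias identity with `f(a) = a` reduces the second moment to a first moment of `1 + W'`.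
  rw [HasFiniteIntegral, lintegral_congr h1,
    lintegral_isolatedCount_mul ν hk n fun a => (a : ℝ≥0∞)]
  have h3 : Measurable fun q : (ℕ → EuclideanSpace ℝ (Fin d)) × (ℕ × (ℕ →
      EuclideanSpace ℝ (Fin d))) => ((1 + thinnedCount k r q.1 q.2.2 q.2.1 : ℕ) : ℝ≥0∞) :=
    (measurable_from_top (f := fun a : ℕ => (a : ℝ≥0∞))).comp
      ((measurable_thinnedCount (d := d) k r).const_add 1)
  rw [← lintegral_simplexSample ν n h3]
  refine lt_of_eq_of_lt (lintegral_congr fun q => ?_) h2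
  have : ((1 : ℝ) + thinnedCount k r q.1 q.2.2 q.2.1) =
    ((1 + thinnedCount k r q.1 q.2.2 q.2.1 : ℕ) : ℝ) := by push_cast; rfl
  simp only [Pi.add_apply, this, Real.enorm_natCast]

/-- The identity for nonnegative functions is an equality of measures on `ℕ`, so it passes to
complex integrands without integrability conditions. -/
lemma integral_isolatedCount_smul (hk : 3 ≤ k) (n : ℝ≥0) (g : ℕ → ℂ) :
    ∫ p, (isolatedCount k r p.2 p.1 : ℝ) • g (isolatedCount k r p.2 p.1) ∂poissonSample ν n =
      ∫ q, g (1 + thinnedCount k r q.1 q.2.2 q.2.1) ∂simplexSample ν k r n := by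
  have hW := measurable_isolatedCount (d := d) k r
  have hT := (measurable_thinnedCount (d := d) k r).const_add 1
  have hWn : Measurable fun p : ℕ × (ℕ → EuclideanSpace ℝ (Fin d)) =>
      (isolatedCount k r p.2 p.1 : ℝ≥0) := measurable_from_top.comp hW
  have hg : StronglyMeasurable g := .of_discrete
  have hlaw : ((poissonSample ν n).withDensity fun p => ((isolatedCount k r p.2 p.1 : ℝ≥0) :
      ℝ≥0∞)).map (fun p => isolatedCount k r p.2 p.1) =
      (simplexSample ν k r n).map fun q => 1 + thinnedCount k r q.1 q.2.2 q.2.1 := by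
    refine Measure.ext_of_lintegral _ fun f hf => ?_
    have hfW : Measurable fun p : ℕ × (ℕ → EuclideanSpace ℝ (Fin d)) =>
      f (isolatedCount k r p.2 p.1) := hf.comp hW
    have hfT : Measurable fun q : (ℕ → EuclideanSpace ℝ (Fin d)) × (ℕ × (ℕ →
      EuclideanSpace ℝ (Fin d))) => f (1 + thinnedCount k r q.1 q.2.2 q.2.1) := hf.comp hT
    rw [lintegral_map hf hW, lintegral_map hf hT, lintegral_withDensity_eq_lintegral_mul _
      hWn.coe_nnreal_ennreal hfW, lintegral_simplexSample ν n hfT,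
      ← lintegral_isolatedCount_mul ν hk n f]
    simp
  calc _ = ∫ p, (isolatedCount k r p.2 p.1 : ℝ≥0) • g (isolatedCount k r p.2 p.1)
        ∂poissonSample ν n := by
        refine integral_congr_ae (ae_of_all _ fun p => ?_)
        simp [NNReal.smul_def]
    _ = _ := by
        rw [← integral_withDensity_eq_integral_smul hWn,
          ← integral_map hW.aemeasurable hg.aestronglyMeasurable, hlaw,
          integral_map hT.aemeasurable hg.aestronglyMeasurable]

/-- Approximate Stein identity for the Poisson distribution, satisfied by the isolated count. -/
theorem norm_integral_isolatedCount_smul_sub_le (hk : 3 ≤ k) (hr : 0 ≤ r) (n ρ : ℝ≥0)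
    (hρ : ∀ v, n * ν (Metric.closedBall v (6 * r)) ≤ ρ) (g : ℕ → ℂ) (c : ℝ) (hc : 0 ≤ c)
    (hg : ∀ a b : ℕ, ‖g a - g b‖ ≤ c * |(a : ℝ) - b|) :
    ‖∫ p, (isolatedCount k r p.2 p.1 : ℝ) • g (isolatedCount k r p.2 p.1) ∂poissonSample ν n -
      (∫ p, (isolatedCount k r p.2 p.1 : ℝ) ∂poissonSample ν n) •
        ∫ p, g (1 + isolatedCount k r p.2 p.1) ∂poissonSample ν n‖ ≤
      c * (2 * ρ * ∫ p, (isolatedCount k r p.2 p.1 : ℝ) ∂poissonSample ν n) := by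
  set lam := ∫ p, (isolatedCount k r p.2 p.1 : ℝ) ∂poissonSample ν n with hlam
  have hlam0 : 0 ≤ lam := integral_nonneg fun p => Nat.cast_nonneg _
  have hη := isFiniteMeasure_withDensity_simplexIntensity (r := r) ν hk n
  have : IsFiniteMeasure (simplexSample ν k r n) := by unfold simplexSample; infer_instance
  have hmass : ((Measure.infinitePi fun _ => ν).withDensity
      fun y => (simplexIntensity ν k r n y : ℝ≥0∞)).real Set.univ = lam := by
    rw [measureReal_def, withDensity_simplexIntensity_univ ν hk,
      ← ofReal_integral_isolatedCount ν hk, ENNReal.toReal_ofReal hlam0]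
  -- The simplex marginal has total mass `lam`, so both terms become integrals over the same product
  -- space, where the counts are compared pointwise.
  have hsecond : lam • ∫ p, g (1 + isolatedCount k r p.2 p.1) ∂poissonSample ν n =
      ∫ q, g (1 + isolatedCount k r q.2.2 q.2.1) ∂simplexSample ν k r n := by
    rw [simplexSample, integral_fun_snd (fun p : ℕ × (ℕ → EuclideanSpace ℝ (Fin d)) =>
      g (1 + isolatedCount k r p.2 p.1)), hmass]
  have hint (V : (ℕ → EuclideanSpace ℝ (Fin d)) × (ℕ × (ℕ → EuclideanSpace ℝ (Fin d))) → ℕ)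
      (hV : Measurable V) (hVi : Integrable (fun q => (V q : ℝ)) (simplexSample ν k r n)) :
      Integrable (fun q => g (1 + V q)) (simplexSample ν k r n) := by
    refine Integrable.mono' ((integrable_const ‖g 1‖).add (hVi.const_mul c))
      ((measurable_from_top (f := g)).comp (hV.const_add 1)).aestronglyMeasurable
      (ae_of_all _ fun q => ?_)
    have h1 := hg (1 + V q) 1
    have h2 := norm_le_insert' (g (1 + V q)) (g 1)
    simp only [Nat.cast_add, Nat.cast_one, add_sub_cancel_left, Nat.abs_cast] at h1
    simpa using h2.trans (by gcongr)
  rw [integral_isolatedCount_smul ν hk, hsecond, ← integral_sub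
    (hint _ (measurable_thinnedCount k r) (integrable_thinnedCount ν hk hr n))
    (hint _ (measurable_isolatedCount_snd k r) (integrable_isolatedCount_snd ν hk n))]
  have hD := integrable_isolatedCount_sub_thinnedCount (r := r) ν hk hr n
  calc _ ≤ ∫ q, c * ‖(isolatedCount k r q.2.2 q.2.1 : ℝ) - thinnedCount k r q.1 q.2.2 q.2.1‖
          ∂simplexSample ν k r n := by
        refine norm_integral_le_of_norm_le (hD.norm.const_mul c) (ae_of_all _ fun q => ?_)
        refine (hg _ _).trans_eq ?_
        rw [Real.norm_eq_abs, abs_sub_comm]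
        push_cast
        ring_nf
    _ ≤ c * (2 * ρ * lam) := by
        rw [integral_const_mul]
        gcongr
        rw [integral_norm_eq_lintegral_enorm hD.aestronglyMeasurable]
        refine ENNReal.toReal_le_of_le_ofReal (by positivity) ?_
        refine (lintegral_enorm_isolatedCount_sub_thinnedCount_le ν hk hr n ρ hρ).trans_eq ?_
        rw [ENNReal.ofReal_mul (by positivity), ofReal_integral_isolatedCount ν hk,
          ENNReal.ofReal_mul (by norm_num)]
        simp

/-- A lower bound for the expected isolated count. -/
lemma le_lintegral_isolatedCount (hk : 3 ≤ k) (hr : 0 ≤ r) (n ρ : ℝ≥0)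
    (hρ : ∀ v, n * ν (Metric.closedBall v (6 * r)) ≤ ρ) :
    ENNReal.ofReal (n ^ k / k.factorial * Real.exp (-ρ)) *
        Measure.infinitePi (fun _ => ν) {y | IsEmptySimplex r y (Finset.range k)} ≤
      ∫⁻ p, (isolatedCount k r p.2 p.1 : ℝ≥0∞) ∂poissonSample ν n := by
  rw [lintegral_isolatedCount ν hk, ← lintegral_indicator_const (measurableSet_isEmptySimplex r _)]
  refine lintegral_mono fun y => ?_
  by_cases hy : IsEmptySimplex r y (Finset.range k)
  · rw [Set.indicator_of_mem (by exact hy), simplexIntensity, if_pos hy, ENNReal.ofReal,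
      Real.toNNReal_mul (by positivity)]
    have h1 : (n : ℝ) * (ν (nearSet r y (Finset.range k))).toReal ≤ ρ := by
      have h2 : n * ν (nearSet r y (Finset.range k)) ≤ ρ :=
        le_trans (by gcongr; exact fun v hv =>
          (nearSet_subset_closedBall hk hy hv).trans (by linarith)) (hρ (y 0))
      have := ENNReal.toReal_mono ENNReal.coe_ne_top h2
      simpa using this
    have h3 : ((n : ℝ) ^ k / k.factorial).toNNReal = n ^ k / k.factorial := by
      rw [← NNReal.coe_natCast, ← NNReal.coe_pow, ← NNReal.coe_div, Real.toNNReal_coe]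
    rw [h3]
    gcongr
  · simp [hy]

end SteinBound

/-! ### From the Stein identity to Gaussian characteristic functions -/

section CharFun

open Complex in
lemma norm_exp_I_mul_sub_one_sub_le (x : ℝ) :
    ‖Complex.exp (x * I) - 1 - x * I‖ ≤ 2 * x ^ 2 := by
  have hx : ‖(x : ℂ) * I‖ = |x| := by simp
  rcases le_total |x| 1 with h | h
  · have := norm_exp_sub_one_sub_id_le (x := x * I) (by rwa [hx])
    rw [hx, sq_abs] at this
    nlinarith [sq_nonneg x]
  · have h1 : ‖Complex.exp (x * I) - 1‖ ≤ |x| := by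
      have := Real.norm_exp_I_mul_ofReal_sub_one_le (x := x)
      rwa [mul_comm, Real.norm_eq_abs] at this
    have h2 := norm_sub_le (Complex.exp (x * I) - 1) (x * I)
    rw [hx] at h2
    rw [← sq_abs]
    nlinarith

open Complex in
/-- If `m` nearly satisfies the equation `E[Z exp(isZ)] = i s E[exp(isZ)]` that characterizes the
standard Gaussian law, then its characteristic function is close to that of this law. -/
lemma norm_charFun_sub_exp_le {m : Measure ℝ} [IsProbabilityMeasure m] (hm : MemLp id 1 m)
    {δ : ℝ} (hδ : 0 ≤ δ)
    (h : ∀ s : ℝ, ‖∫ x, x * Complex.exp (s * x * I) ∂m - I * s * charFun m s‖ ≤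
      δ * (|s| + s ^ 2)) (t : ℝ) :
    ‖charFun m t - Complex.exp (-(t ^ 2 / 2 : ℝ))‖ ≤
      δ * (|t| + t ^ 2) * Real.exp (t ^ 2 / 2) * |t| := by
  have hd (s : ℝ) : HasDerivAt (charFun m) (I * ∫ x, x * Complex.exp (s * x * I) ∂m) s := by
    have h1 : DifferentiableAt ℝ (charFun m) s :=
      ((contDiff_charFun (n := 1) (by simpa using hm)).differentiable (by simp)) s
    have h2 := iteratedDeriv_charFun (n := 1) (t := s) (by simpa using hm)
    rw [iteratedDeriv_one] at h2
    simpa [h2] using h1.hasDerivAt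
  have hexp (s : ℝ) : HasDerivAt (fun s : ℝ => Complex.exp ((s ^ 2 / 2 : ℝ)))
      (Complex.exp ((s ^ 2 / 2 : ℝ)) * (s : ℝ)) s := by
    have h1 : HasDerivAt (fun s : ℝ => s ^ 2 / 2) s s := by
      have := (hasDerivAt_pow 2 s).div_const 2
      simpa using this
    exact h1.ofReal_comp.cexp
  -- Integrating factor: the product of `charFun m` with `exp(s²/2)` would be constant if the
  -- equation held exactly, so its derivative is small.
  have hfd (s : ℝ) := (hd s).mul (hexp s)
  have hbound : ∀ s ∈ Metric.closedBall (0 : ℝ) |t|,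
      ‖I * (∫ x, x * Complex.exp (s * x * I) ∂m) * Complex.exp ((s ^ 2 / 2 : ℝ)) +
        charFun m s * (Complex.exp ((s ^ 2 / 2 : ℝ)) * (s : ℝ))‖ ≤
      δ * (|t| + t ^ 2) * Real.exp (t ^ 2 / 2) := by
    intro s hs
    rw [mem_closedBall_zero_iff, Real.norm_eq_abs] at hs
    have hs2 : s ^ 2 ≤ t ^ 2 := sq_le_sq.2 hs
    have h1 : I * (∫ x, x * Complex.exp (s * x * I) ∂m) * Complex.exp ((s ^ 2 / 2 : ℝ)) +
        charFun m s * (Complex.exp ((s ^ 2 / 2 : ℝ)) * (s : ℝ)) =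
        I * (∫ x, x * Complex.exp (s * x * I) ∂m - I * s * charFun m s) *
          Complex.exp ((s ^ 2 / 2 : ℝ)) := by
      linear_combination (charFun m s * Complex.exp ((s ^ 2 / 2 : ℝ)) * s) * I_mul_I
    rw [h1, norm_mul, norm_mul, norm_I, one_mul, ← ofReal_exp, norm_real, Real.norm_eq_abs,
      abs_of_pos (Real.exp_pos _)]
    refine mul_le_mul ((h s).trans ?_) (Real.exp_le_exp.2 (by linarith)) (Real.exp_pos _).le
      (by positivity)
    gcongr
  have hmv := (convex_closedBall (0 : ℝ) |t|).norm_image_sub_le_of_norm_hasDerivWithin_le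
    (fun s _ => (hfd s).hasDerivWithinAt) hbound (x := 0) (y := t) (by simp) (by simp)
  have h0 : charFun m 0 = 1 := by simp
  have h2 : charFun m t - Complex.exp (-(t ^ 2 / 2 : ℝ)) =
      (charFun m t * Complex.exp ((t ^ 2 / 2 : ℝ)) - 1) * Complex.exp (-(t ^ 2 / 2 : ℝ)) := by
    rw [sub_mul, mul_assoc, ← Complex.exp_add, add_neg_cancel, Complex.exp_zero, mul_one, one_mul]
  have h3 : ‖Complex.exp (-(t ^ 2 / 2 : ℝ))‖ ≤ 1 := by
    rw [← ofReal_neg, ← ofReal_exp, norm_real, Real.norm_eq_abs, abs_of_pos (Real.exp_pos _),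
      Real.exp_le_one_iff]
    have := sq_nonneg t
    linarith
  rw [h2, norm_mul]
  refine (mul_le_of_le_one_right (norm_nonneg _) h3).trans ?_
  simpa [h0] using hmv

lemma norm_cexp_sub_cexp_le (x y : ℝ) :
    ‖Complex.exp (x * Complex.I) - Complex.exp (y * Complex.I)‖ ≤ |x - y| := by
  have h1 : Complex.exp (x * Complex.I) - Complex.exp (y * Complex.I) =
      Complex.exp (y * Complex.I) * (Complex.exp (Complex.I * (x - y : ℝ)) - 1) := by
    rw [mul_sub, ← Complex.exp_add, mul_one]
    congr 2
    push_cast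
    ring
  rw [h1, norm_mul, Complex.norm_exp_ofReal_mul_I, one_mul]
  exact Real.norm_exp_I_mul_ofReal_sub_one_le

variable {Ω : Type*} [MeasurableSpace Ω] {Q : Measure Ω} [IsProbabilityMeasure Q] {W : Ω → ℕ}

/-- A counting variable that nearly satisfies the Stein identity of the Poisson distribution has a
variance close to its mean. -/
lemma abs_variance_sub_mean_le (hW : MemLp (fun ω => (W ω : ℝ)) 2 Q) {ε : ℝ}
    (hS : ∀ (g : ℕ → ℂ) (c : ℝ), 0 ≤ c → (∀ a b : ℕ, ‖g a - g b‖ ≤ c * |(a : ℝ) - b|) →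
      ‖∫ ω, (W ω : ℝ) • g (W ω) ∂Q - (∫ ω, (W ω : ℝ) ∂Q) • ∫ ω, g (1 + W ω) ∂Q‖ ≤
        c * (ε * ∫ ω, (W ω : ℝ) ∂Q)) :
    |variance (fun ω => (W ω : ℝ)) Q - ∫ ω, (W ω : ℝ) ∂Q| ≤ ε * ∫ ω, (W ω : ℝ) ∂Q := by
  -- With `g(a) = a` the Stein defect is `E[W²] - λ(1 + λ) = Var W - λ`.
  have h := hS (fun a => ((a : ℝ) : ℂ)) 1 zero_le_one fun a b => by
    rw [← Complex.ofReal_sub, Complex.norm_real, one_mul, Real.norm_eq_abs]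
  have h1 : ∫ ω, (W ω : ℝ) • ((W ω : ℝ) : ℂ) ∂Q = ((∫ ω, (W ω : ℝ) ^ 2 ∂Q : ℝ) : ℂ) := by
    rw [← integral_complex_ofReal]
    refine integral_congr_ae (ae_of_all _ fun ω => ?_)
    simp [sq]
  have h2 : ∫ ω, (((1 + W ω : ℕ) : ℝ) : ℂ) ∂Q = ((1 + ∫ ω, (W ω : ℝ) ∂Q : ℝ) : ℂ) := by
    rw [integral_complex_ofReal]
    push_cast
    rw [integral_add (integrable_const _) (hW.integrable one_le_two)]
    simp
  rw [h1, h2, Complex.real_smul, ← Complex.ofReal_mul, ← Complex.ofReal_sub, Complex.norm_real,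
    one_mul, Real.norm_eq_abs] at h
  rw [variance_eq_sub hW]
  convert h using 2
  simp only [Pi.pow_apply]
  ring

open Complex in
/-- A counting variable that nearly satisfies the Stein identity of the Poisson distribution has a
nearly Gaussian characteristic function, after standardization. -/
lemma norm_charFun_standardized_sub_exp_le (hWm : Measurable W)
    (hW : MemLp (fun ω => (W ω : ℝ)) 2 Q) {ε lam σ : ℝ}
    (hlam0 : 0 ≤ lam) (hε : 0 ≤ ε) (hσ : 0 < σ)
    (hS : ∀ (g : ℕ → ℂ) (c : ℝ), 0 ≤ c → (∀ a b : ℕ, ‖g a - g b‖ ≤ c * |(a : ℝ) - b|) →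
      ‖∫ ω, (W ω : ℝ) • g (W ω) ∂Q - lam • ∫ ω, g (1 + W ω) ∂Q‖ ≤ c * (ε * lam)) (t : ℝ) :
    ‖charFun (Q.map fun ω => ((W ω : ℝ) - lam) / σ) t - Complex.exp (-(t ^ 2 / 2 : ℝ))‖ ≤
      (ε * (lam / σ ^ 2) + |lam / σ ^ 2 - 1| + 2 * (lam / σ ^ 2) / σ) * (|t| + t ^ 2) *
        Real.exp (t ^ 2 / 2) * |t| := by
  have hWr : Measurable fun ω => (W ω : ℝ) := measurable_from_top.comp hWm
  have hZ : Measurable fun ω => ((W ω : ℝ) - lam) / σ := (hWr.sub_const _).div_const _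
  have hint : Integrable (fun ω => ((W ω : ℝ) - lam) / σ) Q :=
    ((hW.integrable one_le_two).sub (integrable_const _)).div_const _
  have := Measure.isProbabilityMeasure_map (μ := Q) hZ.aemeasurable
  refine norm_charFun_sub_exp_le ?_ (by positivity) (fun s => ?_) t
  · rw [memLp_one_iff_integrable, integrable_map_measure (by fun_prop) hZ.aemeasurable]
    exact hint
  set φ : ℂ := ∫ ω, Complex.exp ((s * (((W ω : ℝ) - lam) / σ) : ℝ) * I) ∂Q with hφ
  have hchar : charFun (Q.map fun ω => ((W ω : ℝ) - lam) / σ) s = φ := by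
    rw [charFun_apply_real, integral_map hZ.aemeasurable (by fun_prop)]
    simp [hφ]
  set g : ℕ → ℂ := fun a => Complex.exp ((s * (((a : ℝ) - lam) / σ) : ℝ) * I) with hg
  have hgW : ∫ ω, g (W ω) ∂Q = φ := rfl
  have hgm : Measurable fun ω => g (W ω) := (measurable_from_top (f := g)).comp hWm
  have hgn (ω) : ‖g (W ω)‖ ≤ 1 := (Complex.norm_exp_ofReal_mul_I _).le
  have hgi : Integrable (fun ω => g (W ω)) Q :=
    Integrable.of_bound hgm.aestronglyMeasurable 1 (ae_of_all _ hgn)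
  -- A unit shift of the count is multiplication by a phase, so the Stein identity closes up in
  -- terms of `φ` alone.
  have hg1 (ω) : g (1 + W ω) = Complex.exp ((s / σ : ℝ) * I) * g (W ω) := by
    simp only [hg]
    rw [← Complex.exp_add]
    congr 1
    push_cast
    field_simp
    ring
  have hst := hS g (|s| / σ) (by positivity) fun a b => by
    refine (norm_cexp_sub_cexp_le _ _).trans_eq ?_
    have : s * (((a : ℝ) - lam) / σ) - s * (((b : ℝ) - lam) / σ) = s / σ * ((a : ℝ) - b) := by ring
    rw [this, abs_mul, abs_div, abs_of_pos hσ]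
  simp only [hg1] at hst
  rw [integral_const_mul, hgW] at hst
  have hWg : Integrable (fun ω => (W ω : ℝ) • g (W ω)) Q := by
    refine Integrable.mono' (hW.integrable one_le_two)
      (hWr.smul hgm).aestronglyMeasurable (ae_of_all _ fun ω => ?_)
    rw [norm_smul, Real.norm_natCast]
    exact mul_le_of_le_one_right (by positivity) (hgn ω)
  have hZint : ∫ x, (x : ℂ) * Complex.exp (s * x * I)
      ∂(Q.map fun ω => ((W ω : ℝ) - lam) / σ) =
      (1 / σ : ℝ) * (∫ ω, (W ω : ℝ) • g (W ω) ∂Q - lam * φ) := by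
    rw [integral_map hZ.aemeasurable (by fun_prop), ← hgW, ← integral_const_mul,
      ← integral_sub hWg (hgi.const_mul _), ← integral_const_mul]
    refine integral_congr_ae (ae_of_all _ fun ω => ?_)
    simp only [hg, real_smul]
    push_cast
    ring
  rw [hchar, hZint]
  have hφ1 : ‖φ‖ ≤ 1 := by
    have := norm_integral_le_of_norm_le_const (μ := Q) (ae_of_all _ hgn)
    simpa using this
  set E := Complex.exp ((s / σ : ℝ) * I) with hE
  -- Three errors: the Stein defect, the mismatch between mean and variance, and the second-order
  -- Taylor remainder of the phase.
  have hdecomp : (1 / σ : ℝ) * (∫ ω, (W ω : ℝ) • g (W ω) ∂Q - lam * φ) - I * s * φ =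
      (1 / σ : ℝ) * (∫ ω, (W ω : ℝ) • g (W ω) ∂Q - lam • (E * φ)) +
        ((lam / σ ^ 2 - 1 : ℝ) : ℂ) * (s * I) * φ +
        ((lam / σ : ℝ) : ℂ) * (E - 1 - (s / σ : ℝ) * I) * φ := by
    have : (σ : ℂ) ≠ 0 := by exact_mod_cast hσ.ne'
    rw [real_smul]
    push_cast
    field_simp
    ring
  have e1 : ‖((1 / σ : ℝ) : ℂ) * (∫ ω, (W ω : ℝ) • g (W ω) ∂Q - lam • (E * φ))‖ ≤
      ε * (lam / σ ^ 2) * |s| := by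
    rw [norm_mul, norm_real, Real.norm_eq_abs, abs_of_pos (by positivity)]
    calc 1 / σ * _ ≤ 1 / σ * (|s| / σ * (ε * lam)) := by gcongr
      _ = _ := by field_simp
  have e2 : ‖((lam / σ ^ 2 - 1 : ℝ) : ℂ) * (s * I) * φ‖ ≤ |lam / σ ^ 2 - 1| * |s| := by
    rw [norm_mul, norm_mul, norm_mul, norm_real, norm_real, norm_I, mul_one, Real.norm_eq_abs,
      Real.norm_eq_abs]
    exact mul_le_of_le_one_right (by positivity) hφ1
  have e3 : ‖((lam / σ : ℝ) : ℂ) * (E - 1 - (s / σ : ℝ) * I) * φ‖ ≤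
      2 * (lam / σ ^ 2) / σ * s ^ 2 := by
    rw [norm_mul, norm_mul, norm_real, Real.norm_eq_abs, abs_of_nonneg (by positivity)]
    refine (mul_le_of_le_one_right (by positivity) hφ1).trans ?_
    calc lam / σ * ‖E - 1 - (s / σ : ℝ) * I‖ ≤ lam / σ * (2 * (s / σ) ^ 2) := by
          gcongr
          exact norm_exp_I_mul_sub_one_sub_le _
      _ = _ := by field_simp
  rw [hdecomp]
  refine (norm_add₃_le).trans ((add_le_add_three e1 e2 e3).trans ?_)
  have p1 : 0 ≤ ε * (lam / σ ^ 2) := by positivity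
  have p2 : 0 ≤ |lam / σ ^ 2 - 1| := by positivity
  have p3 : 0 ≤ 2 * (lam / σ ^ 2) / σ := by positivity
  have p4 := sq_nonneg s
  have p5 := abs_nonneg s
  nlinarith [mul_nonneg p1 p4, mul_nonneg p2 p4, mul_nonneg p3 p5]

/-- Central limit theorem for counting variables that asymptotically satisfy the Stein identity of
the Poisson distribution and whose means tend to infinity. -/
theorem tendsto_charFun_standardized {Q : ℕ → Measure Ω} [∀ n, IsProbabilityMeasure (Q n)]
    {W : ℕ → Ω → ℕ} (hWm : ∀ n, Measurable (W n))
    (hW : ∀ n, MemLp (fun ω => (W n ω : ℝ)) 2 (Q n)) {ε : ℕ → ℝ} (hε0 : ∀ n, 0 ≤ ε n)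
    (hε : Tendsto ε atTop (𝓝 0))
    (hlam : Tendsto (fun n => ∫ ω, (W n ω : ℝ) ∂Q n) atTop atTop)
    (hS : ∀ n, ∀ (g : ℕ → ℂ) (c : ℝ), 0 ≤ c →
      (∀ a b : ℕ, ‖g a - g b‖ ≤ c * |(a : ℝ) - b|) →
      ‖∫ ω, (W n ω : ℝ) • g (W n ω) ∂Q n -
        (∫ ω, (W n ω : ℝ) ∂Q n) • ∫ ω, g (1 + W n ω) ∂Q n‖ ≤
        c * (ε n * ∫ ω, (W n ω : ℝ) ∂Q n)) (t : ℝ) :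
    Tendsto (fun n => charFun ((Q n).map fun ω => ((W n ω : ℝ) - ∫ ω, (W n ω : ℝ) ∂Q n) /
      √(variance (fun ω => (W n ω : ℝ)) (Q n))) t) atTop
      (𝓝 (Complex.exp (-(t ^ 2 / 2 : ℝ)))) := by
  set lam : ℕ → ℝ := fun n => ∫ ω, (W n ω : ℝ) ∂Q n with hlam_def
  set V : ℕ → ℝ := fun n => variance (fun ω => (W n ω : ℝ)) (Q n) with hV_def
  have hVl (n : ℕ) : |V n - lam n| ≤ ε n * lam n := abs_variance_sub_mean_le (hW n) (hS n)
  have hlampos : ∀ᶠ n in atTop, 0 < lam n := hlam.eventually_gt_atTop 0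
  have hratio : Tendsto (fun n => V n / lam n) atTop (𝓝 1) := by
    rw [tendsto_iff_norm_sub_tendsto_zero]
    refine squeeze_zero' (Eventually.of_forall fun _ => norm_nonneg _) ?_ hε
    filter_upwards [hlampos] with n hn
    rw [Real.norm_eq_abs, ← div_self hn.ne', ← sub_div, abs_div, abs_of_pos hn, div_le_iff₀ hn]
    exact hVl n
  have hratio' : Tendsto (fun n => lam n / V n) atTop (𝓝 1) := by
    have := hratio.inv₀ one_ne_zero
    simpa using this
  have hVtop : Tendsto V atTop atTop := by
    refine (hratio.pos_mul_atTop one_pos hlam).congr' ?_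
    filter_upwards [hlampos] with n hn
    field_simp
  have hσtop : Tendsto (fun n => √(V n)) atTop atTop := Real.tendsto_sqrt_atTop.comp hVtop
  rw [tendsto_iff_norm_sub_tendsto_zero]
  have hlim : Tendsto (fun n => (ε n * (lam n / V n) + |lam n / V n - 1| +
      2 * (lam n / V n) / √(V n)) * (|t| + t ^ 2) * Real.exp (t ^ 2 / 2) * |t|) atTop (𝓝 0) := by
    have h1 := ((hε.mul hratio').add (hratio'.sub_const 1).abs).add
      ((hratio'.const_mul 2).div_atTop hσtop)
    have h2 := ((h1.mul_const (|t| + t ^ 2)).mul_const (Real.exp (t ^ 2 / 2))).mul_const |t|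
    simpa using h2
  refine squeeze_zero' (Eventually.of_forall fun _ => norm_nonneg _) ?_ hlim
  filter_upwards [hlampos, hVtop.eventually_gt_atTop 0] with n hn hVn
  have := norm_charFun_standardized_sub_exp_le (hWm n) (hW n) (lam := lam n) (σ := √(V n))
    hn.le (hε0 n) (Real.sqrt_pos.2 hVn) (hS n) t
  rwa [Real.sq_sqrt hVn.le] at this

end CharFun

/-! ### Probability of an empty simplex -/

section LowerBound

variable {d k : ℕ}

open scoped RealInnerProductSpace in
/-- In dimension at least `k - 1` there are `k` unit vectors with negative inner products, not
contained in an open half space. -/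
lemma exists_unit_vectors_inner_neg (hk : 2 ≤ k) (hkd : k ≤ d + 1) :
    ∃ p : ℕ → EuclideanSpace ℝ (Fin d), (∀ i < k, ‖p i‖ = 1) ∧
      (∀ i < k, ∀ j < k, i ≠ j → ⟪p i, p j⟫ < 0) ∧ ∀ z, ∃ i < k, ⟪p i, z⟫ ≤ 0 := by
  obtain ⟨m, rfl⟩ : ∃ m, k = m + 1 := ⟨k - 1, by omega⟩
  have hm : 1 ≤ m := by omega
  have hmd : m ≤ d := by omega
  have hm0 : (m : ℝ) ≠ 0 := by positivity
  have hmpos : (0 : ℝ) < m := by positivity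
  set e : Fin m → EuclideanSpace ℝ (Fin d) := fun i =>
    EuclideanSpace.basisFun (Fin d) ℝ (Fin.castLE hmd i) with he
  have heo : Orthonormal ℝ e :=
    (EuclideanSpace.basisFun (Fin d) ℝ).orthonormal.comp _ (Fin.castLE_injective hmd)
  have hee := orthonormal_iff_ite.1 heo
  set o : EuclideanSpace ℝ (Fin d) := ∑ i, e i with ho
  have heo1 (i : Fin m) : ⟪e i, o⟫ = 1 := by simp [ho, inner_sum, hee]
  have hoe1 (i : Fin m) : ⟪o, e i⟫ = 1 := by rw [real_inner_comm, heo1]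
  have hoo : ⟪o, o⟫ = m := by
    rw [ho, sum_inner, ← ho]
    simp [heo1]
  -- Moving the basis vectors against their sum `o` makes their inner products negative; any `c < 1
  -- / m` also keeps those with `-o` negative. The choice `c = 1 / (2m)` gives `-3 / (4m)` and
  -- `-1/2`.
  set c : ℝ := 1 / (2 * m) with hc
  set u : ℕ → EuclideanSpace ℝ (Fin d) := fun i => if h : i < m then e ⟨i, h⟩ - c • o else -o
    with hu
  have hneg : ∀ i < m + 1, ∀ j < m + 1, i ≠ j → ⟪u i, u j⟫ < 0 := by
    intro i hi j hj hij
    by_cases h1 : i < m <;> by_cases h2 : j < m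
    · have : ⟪u i, u j⟫ = -(3 / (4 * m)) := by
        simp only [hu, h1, h2, dif_pos, inner_sub_left, inner_sub_right, inner_smul_left,
          inner_smul_right, hee, heo1, hoe1, hoo, Fin.mk.injEq, hij, if_false, hc]
        simp only [conj_trivial]
        field_simp
        ring
      rw [this, neg_lt_zero]
      positivity
    · have : ⟪u i, u j⟫ = -(1 / 2) := by
        simp only [hu, h1, h2, dif_pos, dif_neg, not_false_eq_true, inner_sub_left,
          inner_neg_right, inner_smul_left, heo1, hoo, hc]
        simp only [conj_trivial]
        field_simp
        ring
      rw [this]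
      norm_num
    · have : ⟪u i, u j⟫ = -(1 / 2) := by
        simp only [hu, h1, h2, dif_pos, dif_neg, not_false_eq_true, inner_sub_right,
          inner_neg_left, inner_smul_right, hoe1, hoo, hc]
        field_simp
        ring
      rw [this]
      norm_num
    · omega
  -- A vanishing positive combination prevents all the vectors from having positive inner product
  -- with one `z`.
  have hsum : ∑ i ∈ Finset.range m, u i + (1 / 2 : ℝ) • u m = 0 := by
    have h1 : ∑ i ∈ Finset.range m, u i = ∑ i : Fin m, (e i - c • o) := by
      rw [← Fin.sum_univ_eq_sum_range]
      refine Finset.sum_congr rfl fun i _ => ?_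
      simp [hu]
    have h2 : u m = -o := by simp [hu]
    rw [h1, h2, Finset.sum_sub_distrib, ← ho, Finset.sum_const, Finset.card_univ, Fintype.card_fin,
      ← Nat.cast_smul_eq_nsmul ℝ, smul_smul]
    have : (m : ℝ) * c = 1 / 2 := by rw [hc]; field_simp
    rw [this, smul_neg, ← sub_eq_add_neg, sub_sub, ← add_smul]
    norm_num
  have hne : ∀ i < m + 1, u i ≠ 0 := by
    intro i hi h0
    obtain ⟨j, hj, hij⟩ : ∃ j < m + 1, i ≠ j := by
      rcases Nat.eq_zero_or_pos i with rfl | h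
      · exact ⟨1, by omega, by omega⟩
      · exact ⟨0, by omega, by omega⟩
    have := hneg i hi j hj hij
    rw [h0, inner_zero_left] at this
    exact lt_irrefl _ this
  refine ⟨fun i => ‖u i‖⁻¹ • u i, fun i hi => ?_, fun i hi j hj hij => ?_, fun z => ?_⟩
  · rw [norm_smul, norm_inv, norm_norm, inv_mul_cancel₀ (norm_ne_zero_iff.2 (hne i hi))]
  · rw [real_inner_smul_left, real_inner_smul_right]
    have h1 := inv_pos.2 (norm_pos_iff.2 (hne i hi))
    have h2 := inv_pos.2 (norm_pos_iff.2 (hne j hj))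
    exact mul_neg_of_pos_of_neg h1 (mul_neg_of_pos_of_neg h2 (hneg i hi j hj hij))
  · by_contra! hz
    have hpos : ∀ i < m + 1, 0 < ⟪u i, z⟫ := by
      intro i hi
      have := hz i hi
      rw [real_inner_smul_left] at this
      exact (mul_pos_iff_of_pos_left (inv_pos.2 (norm_pos_iff.2 (hne i hi)))).1 this
    have h0 := congrArg (fun v => ⟪v, z⟫) hsum
    simp only [inner_add_left, sum_inner, real_inner_smul_left, inner_zero_left] at h0
    have h1 : 0 ≤ ∑ i ∈ Finset.range m, ⟪u i, z⟫ := Finset.sum_nonneg fun i hi =>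
      (hpos i (by have := Finset.mem_range.1 hi; omega)).le
    have h2 := hpos m (by omega)
    linarith

open scoped RealInnerProductSpace in
/-- The empty simplices of a given radius contain a ball of configurations, up to translation. -/
lemma exists_isEmptySimplex_of_dist_le (hk : 2 ≤ k) (hkd : k ≤ d + 1) :
    ∃ q : ℕ → EuclideanSpace ℝ (Fin d), ∃ η : ℝ, 0 < η ∧ ∀ (r : ℝ), 0 < r →
      ∀ (u : EuclideanSpace ℝ (Fin d)) (x : ℕ → EuclideanSpace ℝ (Fin d)),
        (∀ i < k, dist (x i) (u + r • q i) ≤ r * η) → IsEmptySimplex r x (Finset.range k) := by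
  obtain ⟨p, hp1, hpneg, hpz⟩ := exists_unit_vectors_inner_neg hk hkd
  obtain ⟨γ, hγ0, hγ⟩ : ∃ γ : ℝ, 0 < γ ∧ ∀ i < k, ∀ j < k, i ≠ j → ⟪p i, p j⟫ ≤ -γ := by
    obtain ⟨a, ha, hmin⟩ := Finset.exists_min_image (Finset.range k ×ˢ Finset.range k)
      (fun a => if a.1 = a.2 then (1 : ℝ) else -⟪p a.1, p a.2⟫)
      ⟨(0, 0), by simp; omega⟩
    refine ⟨if a.1 = a.2 then (1 : ℝ) else -⟪p a.1, p a.2⟫, ?_, fun i hi j hj hij => ?_⟩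
    · split_ifs with h
      · exact one_pos
      · simp only [Finset.mem_product, Finset.mem_range] at ha
        linarith [hpneg a.1 ha.1 a.2 ha.2 h]
    · have := hmin (i, j) (by simp [hi, hj])
      simp only [hij, if_false] at this
      linarith
  have hγ1 : γ ≤ 1 := by
    have h1 := hγ 0 (by omega) 1 (by omega) (by omega)
    have h2 := neg_le_of_abs_le (abs_real_inner_le_norm (p 0) (p 1))
    rw [hp1 0 (by omega), hp1 1 (by omega)] at h2
    linarith
  -- The points sit at distance `r(1 + 2η)` from `u`, leaving slack `rη` for perturbation. Moving
  -- the centre by `rγ` away from `p j` brings the other points within `r(1 - η)`, since `(1 + 2η)²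
  -- - 9η(1 + 4η) ≤ (1 - η)²`.
  set η : ℝ := γ ^ 2 / 9 with hη
  have hη0 : 0 < η := by positivity
  have hη1 : η ≤ 1 := by rw [hη]; nlinarith
  have hγη : γ ^ 2 = 9 * η := by rw [hη]; ring
  refine ⟨fun i => (1 + 2 * η) • p i, η, hη0, fun r hr u x hx => ⟨fun j hj => ?_, ?_⟩⟩
  · rw [Finset.mem_range] at hj
    refine ⟨u - (r * γ) • p j, ?_⟩
    simp only [Set.mem_iInter, Metric.mem_closedBall]
    intro i hi
    obtain ⟨hij, hi⟩ := Finset.mem_erase.1 hi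
    rw [Finset.mem_range] at hi
    have h1 : dist (u - (r * γ) • p j) (u + r • (1 + 2 * η) • p i) ≤ r * (1 - η) := by
      have h2 : u - (r * γ) • p j - (u + r • (1 + 2 * η) • p i) =
          -((r * γ) • p j + (r * (1 + 2 * η)) • p i) := by
        rw [smul_smul]; abel
      rw [dist_eq_norm, h2, norm_neg]
      refine le_of_sq_le_sq ?_ (by have := sub_nonneg.2 hη1; positivity)
      rw [norm_add_sq_real, norm_smul, norm_smul, hp1 j hj, hp1 i hi, real_inner_smul_left,
        real_inner_smul_right, Real.norm_eq_abs, Real.norm_eq_abs, mul_one, mul_one, sq_abs,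
        sq_abs]
      have h3 := hγ j hj i hi hij.symm
      have h4 : 2 * (r * γ * (r * (1 + 2 * η) * ⟪p j, p i⟫)) ≤
          2 * (r * γ * (r * (1 + 2 * η) * -γ)) := by gcongr
      have h5 : (r * γ) ^ 2 + 2 * (r * γ * (r * (1 + 2 * η) * -γ)) + (r * (1 + 2 * η)) ^ 2 =
          r ^ 2 * ((1 + 2 * η) ^ 2 - γ ^ 2 * (1 + 4 * η)) := by ring
      have h6 : (1 + 2 * η) ^ 2 - γ ^ 2 * (1 + 4 * η) ≤ (1 - η) ^ 2 := by
        rw [hγη]; nlinarith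
      have h7 := mul_le_mul_of_nonneg_left h6 (sq_nonneg r)
      rw [mul_pow r (1 - η)]
      linarith
    have h2 := hx i hi
    have h3 := dist_triangle_right (u - (r * γ) • p j) (x i) (u + r • (1 + 2 * η) • p i)
    linarith
  · rw [Set.eq_empty_iff_forall_notMem]
    intro z hz
    simp only [Set.mem_iInter, Metric.mem_closedBall, Finset.mem_range] at hz
    obtain ⟨i, hi, hiz⟩ := hpz (z - u)
    have h1 : r * (1 + 2 * η) ≤ dist z (u + r • (1 + 2 * η) • p i) := by
      rw [dist_eq_norm, ← sub_sub, smul_smul]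
      refine le_of_sq_le_sq ?_ (norm_nonneg _)
      rw [norm_sub_sq_real, norm_smul, hp1 i hi, real_inner_smul_right, real_inner_comm,
        Real.norm_eq_abs, mul_one, sq_abs]
      have h2 : r * (1 + 2 * η) * ⟪p i, z - u⟫ ≤ 0 :=
        mul_nonpos_of_nonneg_of_nonpos (by positivity) hiz
      nlinarith [sq_nonneg ‖z - u‖]
    have h2 := hx i hi
    have h3 := dist_triangle z (x i) (u + r • (1 + 2 * η) • p i)
    have h4 := hz i hi
    nlinarith

variable {f : EuclideanSpace ℝ (Fin d) → ℝ}

/-- The probability that `k` independent points form an empty simplex of small radius `r` is at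
least of the order `r ^ (d * (k - 1))`. -/
theorem exists_le_infinitePi_isEmptySimplex (hk : 2 ≤ k) (hkd : k ≤ d + 1) (hf : Measurable f)
    (ν : Measure (EuclideanSpace ℝ (Fin d))) [IsProbabilityMeasure ν]
    (hν : ν = volume.withDensity fun x => ENNReal.ofReal (f x))
    {r : ℕ → ℝ} (hr : Tendsto r atTop (𝓝[>] 0)) :
    ∃ c : ℝ, 0 < c ∧ ∀ᶠ n in atTop, ENNReal.ofReal (c * r n ^ (d * (k - 1))) ≤
      Measure.infinitePi (fun _ => ν) {y | IsEmptySimplex (r n) y (Finset.range k)} := by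
  obtain ⟨q, η, hη, hq⟩ := exists_isEmptySimplex_of_dist_le hk hkd
  set P := Measure.infinitePi fun _ : ℕ => ν with hP
  set A : ℕ → Set (ℕ → EuclideanSpace ℝ (Fin d)) :=
    fun n => {y | IsEmptySimplex (r n) y (Finset.range k)} with hA
  have hr0 : ∀ᶠ n in atTop, 0 < r n := hr.eventually self_mem_nhdsWithin
  set b : ℕ → ℝ≥0∞ := fun n =>
    volume (Metric.closedBall (0 : EuclideanSpace ℝ (Fin d)) (r n * η)) with hb
  have hbtop (n) : b n ≠ ∞ := measure_closedBall_lt_top.ne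
  have hb0 : ∀ᶠ n in atTop, b n ≠ 0 := hr0.mono fun n hn =>
    (Metric.measure_closedBall_pos volume _ (by positivity)).ne'
  have hball (n) (w : EuclideanSpace ℝ (Fin d)) :
      volume (Metric.closedBall w (r n * η)) = b n := Measure.addHaar_closedBall_center _ _ _
  set G : ℕ → EuclideanSpace ℝ (Fin d) → ℝ≥0∞ := fun n u =>
    ∏ i ∈ Finset.range k, (ν (Metric.closedBall (u + r n • q i) (r n * η)) / b n) with hG
  have hSm (n) : MeasurableSet {z : EuclideanSpace ℝ (Fin d) × (ℕ → EuclideanSpace ℝ (Fin d)) |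
      ∀ i ∈ Finset.range k, dist (z.2 i) (z.1 + r n • q i) ≤ r n * η} := by
    simp only [Set.ofPred_forall]
    exact Finset.measurableSet_biInter _ fun i _ =>
      measurableSet_le (by fun_prop) measurable_const
  have hGm (n) : Measurable (G n) := by
    refine Finset.measurable_fun_prod _ fun i _ => Measurable.div_const ?_ _
    have : MeasurableSet {z : EuclideanSpace ℝ (Fin d) × EuclideanSpace ℝ (Fin d) |
        dist z.2 (z.1 + r n • q i) ≤ r n * η} :=
      measurableSet_le (by fun_prop) measurable_const
    exact measurable_measure_prodMk_left this
  -- Fubini over the centre `u`: for a fixed configuration, the admissible centres lie in one ball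
  -- of volume `b n`, and there are none unless it is an empty simplex. This costs one of the `k`
  -- factors `b n`.
  have hGP : ∀ᶠ n in atTop, (∫⁻ u, G n u) * b n ^ (k - 1) ≤ P (A n) := by
    filter_upwards [hr0, hb0] with n hn hbn
    have h1 (u : EuclideanSpace ℝ (Fin d)) : G n u * b n ^ k =
        P {y | ∀ i ∈ Finset.range k, dist (y i) (u + r n • q i) ≤ r n * η} := by
      have h2 : {y : ℕ → EuclideanSpace ℝ (Fin d) |
          ∀ i ∈ Finset.range k, dist (y i) (u + r n • q i) ≤ r n * η} =
          ((Finset.range k : Finset ℕ) : Set ℕ).pi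
            fun i => Metric.closedBall (u + r n • q i) (r n * η) := by
        ext y; simp [Set.mem_pi]
      rw [h2, Measure.infinitePi_pi _ fun _ _ => Metric.isClosed_closedBall.measurableSet]
      simp only [hG]
      have h3 : b n ^ k = ∏ _i ∈ Finset.range k, b n := by simp
      rw [h3, ← Finset.prod_mul_distrib]
      exact Finset.prod_congr rfl fun i _ => ENNReal.div_mul_cancel hbn (hbtop n)
    have h4 : (∫⁻ u, G n u) * b n ^ k ≤ P (A n) * b n := by
      rw [← lintegral_mul_const _ (hGm n), lintegral_congr h1]
      have h5 := Measure.prod_apply (μ := volume) (ν := P) (hSm n)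
      have h6 := Measure.prod_apply_symm (μ := volume) (ν := P) (hSm n)
      calc _ = (volume.prod P) _ := h5.symm
        _ = _ := h6
        _ ≤ ∫⁻ y, (A n).indicator (fun _ => b n) y ∂P := by
          refine lintegral_mono fun y => ?_
          by_cases hy : y ∈ A n
          · rw [Set.indicator_of_mem hy, ← hball n (y 0 - r n • q 0)]
            refine measure_mono fun u hu => ?_
            have := hu 0 (Finset.mem_range.2 (by omega))
            rw [Metric.mem_closedBall, dist_comm, dist_eq_norm]
            rw [dist_eq_norm] at this
            convert this using 2
            simp only
            abel
          · rw [Set.indicator_of_notMem hy, nonpos_iff_eq_zero]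
            convert measure_empty (μ := volume)
            rw [Set.eq_empty_iff_forall_notMem]
            exact fun u hu => hy (hq (r n) hn u y fun i hi => hu i (Finset.mem_range.2 hi))
        _ = _ := by rw [lintegral_indicator_const (measurableSet_isEmptySimplex _ _), mul_comm]
    obtain ⟨j, rfl⟩ : ∃ j, k = j + 1 := ⟨k - 1, by omega⟩
    rw [pow_succ, ← mul_assoc] at h4
    exact (ENNReal.mul_le_mul_iff_left hbn (hbtop n)).1 h4
  -- Lebesgue differentiation along off-centre balls: the centres are displaced from `u` by a fixed
  -- multiple `‖q i‖ / η` of the radius, which a doubling measure allows.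
  have hlim : ∀ᵐ u, Tendsto (fun n => G n u) atTop (𝓝 (ENNReal.ofReal (f u) ^ k)) := by
    have hδ : Tendsto (fun n => r n * η) atTop (𝓝[>] 0) := by
      rw [tendsto_nhdsWithin_iff] at hr ⊢
      exact ⟨by simpa using hr.1.mul_const η, hr0.mono fun n hn => mul_pos hn hη⟩
    have h1 (i : ℕ) : ∀ᵐ u, Tendsto (fun n =>
        ν (Metric.closedBall (u + r n • q i) (r n * η)) / b n) atTop
        (𝓝 (ENNReal.ofReal (f u))) := by
      have hrn : ν.rnDeriv volume =ᵐ[volume] fun u => ENNReal.ofReal (f u) := by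
        rw [hν]
        exact Measure.rnDeriv_withDensity _ hf.ennreal_ofReal
      filter_upwards [(IsUnifLocDoublingMeasure.vitaliFamily volume
        (‖q i‖ / η)).ae_tendsto_rnDeriv ν, hrn] with u hu hfu
      rw [← hfu]
      have h2 := hu.comp (IsUnifLocDoublingMeasure.tendsto_closedBall_filterAt
        (K := ‖q i‖ / η) (x := u) volume
        (fun n => u + r n • q i) (fun n => r n * η) hδ (hr0.mono fun n hn => ?_))
      · refine h2.congr fun n => ?_
        simp only [Function.comp_apply, hball]
      · rw [Metric.mem_closedBall, dist_eq_norm, sub_add_cancel_left, norm_neg, norm_smul,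
          Real.norm_eq_abs, abs_of_pos hn]
        apply le_of_eq
        field_simp
    filter_upwards [ae_all_iff.2 h1] with u hu
    simpa using ENNReal.tendsto_finsetProd_of_ne_top (Finset.range k) (fun i _ => hu i)
      fun _ _ => ENNReal.ofReal_ne_top
  have hpos : 0 < ∫⁻ u, ENNReal.ofReal (f u) ^ k := by
    rw [pos_iff_ne_zero]
    intro h0
    rw [lintegral_eq_zero_iff (hf.ennreal_ofReal.pow_const k)] at h0
    have h1 : (fun u => ENNReal.ofReal (f u)) =ᵐ[volume] 0 := h0.mono fun u hu =>
      eq_zero_of_pow_eq_zero hu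
    have h2 : ν Set.univ = 0 := by
      rw [hν, withDensity_apply _ .univ, setLIntegral_univ, lintegral_congr_ae h1]
      simp
    simp at h2
  obtain ⟨c, hc0, hc⟩ := ENNReal.lt_iff_exists_nnreal_btwn.1 hpos
  -- Fatou's lemma gives the lower bound directly, without a dominating function.
  have hfatou : ∀ᶠ n in atTop, (c : ℝ≥0∞) < ∫⁻ u, G n u := by
    refine eventually_lt_of_lt_liminf (hc.trans_le ?_)
    calc ∫⁻ u, ENNReal.ofReal (f u) ^ k = ∫⁻ u, liminf (fun n => G n u) atTop :=
          lintegral_congr_ae (hlim.mono fun u hu => hu.liminf_eq.symm)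
      _ ≤ _ := lintegral_liminf_le hGm
  set v := volume (Metric.closedBall (0 : EuclideanSpace ℝ (Fin d)) 1) with hv
  have hvtop : v ≠ ∞ := measure_closedBall_lt_top.ne
  have hv0 : 0 < v := Metric.measure_closedBall_pos volume _ one_pos
  have hv0' : 0 < v.toReal := ENNReal.toReal_pos hv0.ne' hvtop
  have hc0' : (0 : ℝ) < c := by exact_mod_cast hc0
  refine ⟨c * (η ^ d * v.toReal) ^ (k - 1), by positivity, ?_⟩
  filter_upwards [hr0, hGP, hfatou] with n hn h1 h2
  refine le_trans (le_trans (le_of_eq ?_) (mul_le_mul_left h2.le _)) h1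
  have h3 : b n = ENNReal.ofReal ((r n * η) ^ d * v.toReal) := by
    rw [hb, ENNReal.ofReal_mul (by positivity), ENNReal.ofReal_toReal hvtop]
    simp only
    rw [Measure.addHaar_closedBall' volume _ (by positivity), finrank_euclideanSpace_fin]
  rw [h3, ← ENNReal.ofReal_pow (by positivity), ← ENNReal.ofReal_coe_nnreal,
    ← ENNReal.ofReal_mul (by positivity)]
  congr 1
  rw [pow_mul]
  ring

/-- A measure with a density bounded by `M` gives a ball at most `M` times its volume. -/
lemma withDensity_closedBall_le {M : ℝ} (hM : ∀ x, f x ≤ M) (v : EuclideanSpace ℝ (Fin d))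
    {s : ℝ} (hs : 0 ≤ s) :
    (volume.withDensity fun x => ENNReal.ofReal (f x)) (Metric.closedBall v s) ≤
      ENNReal.ofReal (M * (volume.real (Metric.closedBall (0 : EuclideanSpace ℝ (Fin d)) 1) *
        s ^ d)) := by
  by_cases hM0 : 0 ≤ M
  · rw [withDensity_apply _ Metric.isClosed_closedBall.measurableSet, ENNReal.ofReal_mul hM0]
    calc _ ≤ ∫⁻ _ in Metric.closedBall v s, ENNReal.ofReal M :=
          lintegral_mono fun x => ENNReal.ofReal_le_ofReal (hM x)
      _ = _ := by
          rw [lintegral_const, Measure.restrict_apply_univ,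
            Measure.addHaar_closedBall' volume _ hs, finrank_euclideanSpace_fin,
            ENNReal.ofReal_mul (by positivity), measureReal_def,
            ENNReal.ofReal_toReal measure_closedBall_lt_top.ne, mul_comm (volume _)]
  -- For `M < 0` the truncation in `ENNReal.ofReal` makes the measure zero.
  · have : (fun x => ENNReal.ofReal (f x)) = 0 := funext fun x =>
      ENNReal.ofReal_of_nonpos ((hM x).trans (not_le.1 hM0).le)
    simp [this]

end LowerBound

/-! ### Consequences of the growth and sparsity conditions -/

section Limits

variable {d k : ℕ}

/-- Sparsity forces `r n → 0`; divergence of the other quantity excludes `r n = 0` eventually,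
because the exponent `d * (k - 1)` is not zero. -/
lemma tendsto_nhdsGT_zero_of_sparse (hk : 2 ≤ k) (hd : d ≠ 0) {r : ℕ → ℝ} (hr : ∀ n, 0 ≤ r n)
    (h_infty : Tendsto (fun n : ℕ => (n : ℝ) ^ k * r n ^ (d * (k - 1))) atTop atTop)
    (h_sparse : Tendsto (fun n : ℕ => (n : ℝ) * r n ^ d) atTop (𝓝 0)) :
    Tendsto r atTop (𝓝[>] 0) := by
  rw [tendsto_nhdsWithin_iff]
  constructor
  · rw [Metric.tendsto_atTop']
    intro ε hε
    have h1 := (h_sparse.eventually_lt_const (show 0 < ε ^ d by positivity)).and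
      (eventually_ge_atTop 1)
    obtain ⟨m, hm⟩ := eventually_atTop.1 h1
    refine ⟨m, fun n hn => ?_⟩
    obtain ⟨h2, h3⟩ := hm n hn.le
    rw [Real.dist_eq, sub_zero, abs_of_nonneg (hr n)]
    refine lt_of_pow_lt_pow_left₀ d hε.le (lt_of_le_of_lt ?_ h2)
    exact le_mul_of_one_le_left (pow_nonneg (hr n) d) (by exact_mod_cast h3)
  · filter_upwards [h_infty.eventually_gt_atTop 0] with n hn
    refine (hr n).lt_of_ne fun h0 => ?_
    rw [← h0, zero_pow (Nat.mul_ne_zero hd (by omega)), mul_zero] at hn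
    exact lt_irrefl _ hn

variable {f : EuclideanSpace ℝ (Fin d) → ℝ} {M : ℝ}

/-- The expected number of points in a ball of radius `6 * r n` is at most this. -/
noncomputable def ballMeanBound (d : ℕ) (M : ℝ) (r : ℕ → ℝ) (n : ℕ) : ℝ≥0 :=
  Real.toNNReal (6 ^ d * M * volume.real (Metric.closedBall (0 : EuclideanSpace ℝ (Fin d)) 1) *
    (n * r n ^ d))

lemma mul_withDensity_closedBall_le (hM : ∀ x, f x ≤ M) {r : ℕ → ℝ} (hr : ∀ n, 0 ≤ r n) (n : ℕ)
    (v : EuclideanSpace ℝ (Fin d)) :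
    ((n : ℝ≥0) : ℝ≥0∞) * (volume.withDensity fun x => ENNReal.ofReal (f x))
      (Metric.closedBall v (6 * r n)) ≤ ballMeanBound d M r n := by
  have h := withDensity_closedBall_le hM v (mul_nonneg (by norm_num : (0 : ℝ) ≤ 6) (hr n))
  calc _ ≤ ((n : ℝ≥0) : ℝ≥0∞) * _ := mul_le_mul_right h _
    _ = _ := by
      rw [← ENNReal.ofReal_coe_nnreal, ← ENNReal.ofReal_mul (by positivity), ballMeanBound,
        ENNReal.ofReal]
      congr 2
      push_cast
      ring

lemma tendsto_ballMeanBound (d : ℕ) (M : ℝ) {r : ℕ → ℝ}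
    (h_sparse : Tendsto (fun n : ℕ => (n : ℝ) * r n ^ d) atTop (𝓝 0)) :
    Tendsto (fun n => (ballMeanBound d M r n : ℝ)) atTop (𝓝 0) := by
  have h1 := h_sparse.const_mul
    (6 ^ d * M * volume.real (Metric.closedBall (0 : EuclideanSpace ℝ (Fin d)) 1))
  rw [mul_zero] at h1
  have h2 : Tendsto (ballMeanBound d M r) atTop (𝓝 (Real.toNNReal 0)) :=
    (continuous_real_toNNReal.tendsto 0).comp h1
  rw [Real.toNNReal_zero] at h2
  exact NNReal.tendsto_coe.2 h2

/-- The expected number of isolated empty simplices tends to infinity. -/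
lemma tendsto_integral_isolatedCount (hk : 3 ≤ k) (hkd : k ≤ d + 1) (hf : Measurable f)
    (hM : ∀ x, f x ≤ M) (ν : Measure (EuclideanSpace ℝ (Fin d))) [IsProbabilityMeasure ν]
    (hν : ν = volume.withDensity fun x => ENNReal.ofReal (f x))
    {r : ℕ → ℝ} (hr : ∀ n, 0 ≤ r n)
    (h_infty : Tendsto (fun n : ℕ => (n : ℝ) ^ k * r n ^ (d * (k - 1))) atTop atTop)
    (h_sparse : Tendsto (fun n : ℕ => (n : ℝ) * r n ^ d) atTop (𝓝 0)) :
    Tendsto (fun n : ℕ => ∫ p, (isolatedCount k (r n) p.2 p.1 : ℝ) ∂poissonSample ν (n : ℝ≥0))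
      atTop atTop := by
  obtain ⟨c, hc, hev⟩ := exists_le_infinitePi_isEmptySimplex (by omega) hkd hf ν hν
    (tendsto_nhdsGT_zero_of_sparse (k := k) (by omega) (by omega) hr h_infty h_sparse)
  have hρ1 : ∀ᶠ n in atTop, (ballMeanBound d M r n : ℝ) ≤ 1 :=
    (tendsto_ballMeanBound d M h_sparse).eventually_le_const one_pos
  -- Once the ball mean is at most `1`, the void probability is at least `exp (-1)`.
  refine tendsto_atTop_mono' _ ?_ (h_infty.const_mul_atTop
    (show 0 < c * Real.exp (-1) / k.factorial by positivity))
  filter_upwards [hev, hρ1] with n h1 h2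
  have h3 := le_lintegral_isolatedCount ν hk (hr n) n (ballMeanBound d M r n) fun v => by
    rw [hν]; exact mul_withDensity_closedBall_le hM hr n v
  rw [← ofReal_integral_isolatedCount ν hk] at h3
  have h4 := (mul_le_mul_right h1 _).trans h3
  rw [← ENNReal.ofReal_mul (by positivity)] at h4
  have h5 := (ENNReal.ofReal_le_ofReal_iff (integral_nonneg fun p => Nat.cast_nonneg _)).1 h4
  refine le_trans ?_ h5
  have h6 : Real.exp (-1) ≤ Real.exp (-(ballMeanBound d M r n : ℝ)) :=
    Real.exp_le_exp.2 (by linarith)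
  have h7 : 0 ≤ r n ^ (d * (k - 1)) := pow_nonneg (hr n) _
  calc _ = (n : ℝ) ^ k / k.factorial * Real.exp (-1) * (c * r n ^ (d * (k - 1))) := by ring
    _ ≤ _ := by
      simp only [NNReal.coe_natCast]
      gcongr

end Limits

/-! ### The central limit theorem -/

theorem theorem3p11
    {Ω : Type*} [MeasurableSpace Ω] (μ : Measure Ω) [IsProbabilityMeasure μ]
    (d k : ℕ) (hk : 3 ≤ k) (hkd : k ≤ d + 1)
    (f : EuclideanSpace ℝ (Fin d) → ℝ) (hf : Measurable f) (hf_nonneg : ∀ x, 0 ≤ f x)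
    (hf_bdd : ∃ M : ℝ, ∀ x, f x ≤ M)
    (X : ℕ → Ω → EuclideanSpace ℝ (Fin d)) (hX : ∀ i, Measurable (X i))
    (hX_law : ∀ i, μ.map (X i) = volume.withDensity (fun x => ENNReal.ofReal (f x)))
    (hX_indep : iIndepFun X μ)
    (N : ℕ → Ω → ℕ) (hN : ∀ n, Measurable (N n))
    (hN_law : ∀ n : ℕ, μ.map (N n) = poissonMeasure (n : ℝ≥0))
    (hNX_indep : ∀ n, IndepFun (N n) (fun ω i => X i ω) μ)
    (r : ℕ → ℝ) (hr : ∀ n, 0 ≤ r n)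
    (h_infty : Tendsto (fun n : ℕ => (n : ℝ) ^ k * r n ^ (d * (k - 1))) atTop atTop)
    (h_sparse : Tendsto (fun n : ℕ => (n : ℝ) * r n ^ d) atTop (𝓝 0)) :
    (∀ n, MemLp (poissonizedCount k (r n) X (N n)) 2 μ) ∧
    TendstoInDistribution
      (fun (n : ℕ) (ω : Ω) =>
        (poissonizedCount k (r n) X (N n) ω - ∫ ω', poissonizedCount k (r n) X (N n) ω' ∂μ) /
          √(variance (poissonizedCount k (r n) X (N n)) μ))
      atTop (id : ℝ → ℝ) (fun _ => μ) (gaussianReal 0 1) := by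
  obtain ⟨M, hM⟩ := hf_bdd
  set ν : Measure (EuclideanSpace ℝ (Fin d)) :=
    volume.withDensity (fun x => ENNReal.ofReal (f x)) with hν
  have hνp : IsProbabilityMeasure ν := by
    rw [← hX_law 0]
    exact Measure.isProbabilityMeasure_map (hX 0).aemeasurable
  have hXm : Measurable fun ω i => X i ω := measurable_pi_lambda _ hX
  have hpair (n : ℕ) : Measurable fun ω => (N n ω, fun i => X i ω) := (hN n).prodMk hXm
  -- Moments and limit depend only on the law of each pair `(N n, X)`, so everything transfers to
  -- the model space.
  have hlaw (n : ℕ) : μ.map (fun ω => (N n ω, fun i => X i ω)) = poissonSample ν (n : ℝ≥0) := by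
    rw [(indepFun_iff_map_prod_eq_prod_map_map (hN n).aemeasurable hXm.aemeasurable).1
      (hNX_indep n), hN_law, hX_indep.map_fun_eq_infinitePi_map hX, poissonSample]
    simp only [hX_law]
  have hWm (n : ℕ) : Measurable fun p : ℕ × (ℕ → EuclideanSpace ℝ (Fin d)) =>
      (isolatedCount k (r n) p.2 p.1 : ℝ) :=
    measurable_from_top.comp (measurable_isolatedCount k (r n))
  have hcomp (n : ℕ) : poissonizedCount k (r n) X (N n) =
      (fun p : ℕ × (ℕ → EuclideanSpace ℝ (Fin d)) => (isolatedCount k (r n) p.2 p.1 : ℝ)) ∘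
        fun ω => (N n ω, fun i => X i ω) := rfl
  have hmean (n : ℕ) : ∫ ω, poissonizedCount k (r n) X (N n) ω ∂μ =
      ∫ p, (isolatedCount k (r n) p.2 p.1 : ℝ) ∂poissonSample ν (n : ℝ≥0) := by
    rw [← hlaw, integral_map (hpair n).aemeasurable (hWm n).aestronglyMeasurable]
    rfl
  have hvar (n : ℕ) : variance (poissonizedCount k (r n) X (N n)) μ =
      variance (fun p : ℕ × (ℕ → EuclideanSpace ℝ (Fin d)) =>
        (isolatedCount k (r n) p.2 p.1 : ℝ)) (poissonSample ν (n : ℝ≥0)) := by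
    rw [← hlaw, variance_map (hWm n).aemeasurable (hpair n).aemeasurable, hcomp]
  have hmeas (n : ℕ) : Measurable fun p : ℕ × (ℕ → EuclideanSpace ℝ (Fin d)) =>
      ((isolatedCount k (r n) p.2 p.1 : ℝ) -
        ∫ p, (isolatedCount k (r n) p.2 p.1 : ℝ) ∂poissonSample ν (n : ℝ≥0)) /
        √(variance (fun p : ℕ × (ℕ → EuclideanSpace ℝ (Fin d)) =>
          (isolatedCount k (r n) p.2 p.1 : ℝ)) (poissonSample ν (n : ℝ≥0))) :=
    ((hWm n).sub_const _).div_const _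
  refine ⟨fun n => ?_, ?_⟩
  · rw [hcomp, ← memLp_map_measure_iff (hWm n).aestronglyMeasurable (hpair n).aemeasurable, hlaw]
    exact memLp_two_isolatedCount ν hk (hr n) n
  · have hmap (n : ℕ) : μ.map (fun ω => (poissonizedCount k (r n) X (N n) ω -
        ∫ ω', poissonizedCount k (r n) X (N n) ω' ∂μ) /
          √(variance (poissonizedCount k (r n) X (N n)) μ)) =
        (poissonSample ν (n : ℝ≥0)).map fun p => ((isolatedCount k (r n) p.2 p.1 : ℝ) -
          ∫ p, (isolatedCount k (r n) p.2 p.1 : ℝ) ∂poissonSample ν (n : ℝ≥0)) /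
          √(variance (fun p : ℕ × (ℕ → EuclideanSpace ℝ (Fin d)) =>
            (isolatedCount k (r n) p.2 p.1 : ℝ)) (poissonSample ν (n : ℝ≥0))) := by
      rw [hmean, hvar]
      conv_rhs => rw [← hlaw, Measure.map_map (hlaw n ▸ hmeas n) (hpair n)]
      rw [hlaw]
      rfl
    have haem (n : ℕ) : AEMeasurable (fun ω => (poissonizedCount k (r n) X (N n) ω -
        ∫ ω', poissonizedCount k (r n) X (N n) ω' ∂μ) /
          √(variance (poissonizedCount k (r n) X (N n)) μ)) μ := by
      rw [hmean, hvar]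
      exact ((hmeas n).comp (hpair n)).aemeasurable
    refine ⟨haem, aemeasurable_id, ?_⟩
    refine ProbabilityMeasure.tendsto_of_tendsto_charFun fun t => ?_
    have hmain := tendsto_charFun_standardized
      (Q := fun n : ℕ => poissonSample ν (n : ℝ≥0))
      (W := fun n p => isolatedCount k (r n) p.2 p.1)
      (fun n => measurable_isolatedCount k (r n))
      (fun n => memLp_two_isolatedCount ν hk (hr n) n)
      (ε := fun n => 2 * ballMeanBound d M r n) (fun n => by positivity)
      (by simpa using (tendsto_ballMeanBound d M h_sparse).const_mul 2)
      (tendsto_integral_isolatedCount hk hkd hf hM ν hν hr h_infty h_sparse)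
      (fun n g c hc hg => norm_integral_isolatedCount_smul_sub_le ν hk (hr n) n _
        (mul_withDensity_closedBall_le hM hr n) g c hc hg) t
    simp only [ProbabilityMeasure.coe_mk, hmap, Measure.map_id, charFun_gaussianReal]
    convert hmain using 2
    congr 1
    push_cast
    simp
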